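/- **Gliders.** Let $G$ be a finite group with the chain $1\subset G$ (that is, $G_0=1$ and $G_n=G$ for $n\ge 1$). A glider representation is a $\mathbb{C}G$-module $\Omega$ with a descending chain of subspaces $\Omega\supset M=M_0\supset M_1\supset\cdots$ such that $G_iM_j\subset M_{j-i}$ for $i\le j$. It has zero body if $\bigcap_n M_n=0$, and then it has essential length $1$ if $M_1\ne 0=M_2$. A nonzero glider $M$ is irreducible if every subglider $N$ (a chain $N_n\subset M_n$ that is a glider for the same action) is trivial, i.e. one of the following holds: $N_n=\bigcap_kN_k$ but $M_n\neq\bigcap_kM_k$ for some $n$; $N_n=0\ne M_n$ for some $n$; or $N_n=M_{\alpha(n)}$ for all $n$ with $\alpha$ and $n\mapsto\alpha(n)-n$ non-decreasing. The tensor product of gliders is $\Omega\otimes\Omega'\supset M_0\otimes M_0'\supset M_1\otimes M_1'\supset\cdots$ with diagonal action. An isomorphism of gliders is a linear isomorphism $f:M_0\to M_0'$ with $f(M_n)=M_n'$ and $f(gx)=gf(x)$ for $x\in M_n$, $g\in G_n$. Let $\mathbb{Q}(\tilde G)=\mathbb{Q}\otimes_{\mathbb{Z}}R(\tilde G)$ be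 the $\mathbb{Q}$-algebra of the generalized character ring, taken modulo the character of the glider $\mathbb{C}\supset 0$: it is free over $\mathbb{Q}$ on the generalized characters $\chi_M$ of the isomorphism classes of irreducible gliders of essential length $1$ with zero body, with product $\chi_M\chi_N=\chi_{M\otimes N}$. Here $\chi_{M\otimes N}$ is the character of the irreducible glider $\mathbb{C}G(M_1\otimes N_1)\supset M_1\otimes N_1\supset 0$, since $M\otimes N$ is the fragment direct sum of it and copies of $\mathbb{C}\supset 0$. **Labels.** Let $V_4=\{1,a,b,c\}$ be the Klein four-group; its irreducible characters are labelled by its elements: $T_1$ is trivial, and $T_x$ is the nontrivial character with kernel $\{1,x\}$ for $x\ne 1$. For $A\subset V_4$ nonempty, $\chi_A\in\mathbb{Q}(\tilde V_4)$ is the character of $\bigoplus_{x\in A}T_x\supset\mathbb{C}\sum_{x\in A}t_x\supset 0$, with $0\ne t_x\in T_x$. Let $Q_8=\{\pm1,\pm i,\pm j,\pm k\}$ be the quaternion group, $Q_8\to V_4$ the quotient by the centre with $i\mapsto a$, $j\mapsto b$, $k\mapsto c$, and regard the $T_x$ as representations of $Q_8$. Let $U=\mathbb{C}e_1\oplus\mathbb{C}e_2$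 be the irreducible representation $$i\mapsto\begin{pmatrix}0&\sqrt{-1}\\ \sqrt{-1}&0\end{pmatrix},\qquad j\mapsto\begin{pmatrix}-\sqrt{-1}&0\\0&\sqrt{-1}\end{pmatrix}.$$ For $A\subset V_4$ let $\chi_{(A,\emptyset)}$ (with $A\neq\emptyset$), $\chi_{(A,[\lambda:\mu])}$ (with $[\lambda:\mu]\in\mathbb{P}^1(\mathbb{C})$) and $\chi_{(A,\ast)}$ be the characters in $\mathbb{Q}(\tilde Q_8)$ of the irreducible gliders $\mathbb{C}Q_8v\supset\mathbb{C}v\supset 0$ with, respectively, $v=\sum_{x\in A}t_x$ in $\bigoplus_{x\in A}T_x$, $v=\sum_{x\in A}t_x+(\lambda e_1+\mu e_2)$ in $\bigoplus_{x\in A}T_x\oplus U$, and $v=\sum_{x\in A}t_x+(e_1,e_2)$ in $\bigoplus_{x\in A}T_x\oplus U^{\oplus2}$. A point of $\mathbb{P}^1(\mathbb{C})$ is generic if it is none of $[1:0]$, $[0:1]$, $[1:\pm1]$, $[1:\pm\sqrt{-1}]$. **Theorem.** There is an injective homomorphism of $\mathbb{Q}$-algebras $\iota:\mathbb{Q}(\tilde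 V_4)\to\mathbb{Q}(\tilde Q_8)$ with $\iota(\chi_A)=\chi_{(A,\emptyset)}$ for all nonempty $A\subset V_4$. Let $I'$ be the ideal of $\mathbb{Q}(\tilde Q_8)$ generated by the elements $$\chi_{(\emptyset,p)}-\chi_{(\emptyset,\ast)},\quad p\in\mathbb{P}^1(\mathbb{C})\text{ generic},\qquad\text{and}\qquad \chi_{(A,p)}-\chi_{(V_4,\ast)},\quad \emptyset\ne A\subset V_4,\ p\in\mathbb{P}^1(\mathbb{C})\sqcup\{\ast\}.$$ Then the Jacobson radical of $\mathbb{Q}(\tilde Q_8)$ is $$J(\mathbb{Q}(\tilde Q_8))=I'+\iota\big(J(\mathbb{Q}(\tilde V_4))\big),$$ and there is an isomorphism of $\mathbb{Q}$-algebras $$\mathbb{Q}(\tilde Q_8)/J(\mathbb{Q}(\tilde Q_8))\;\cong\;\mathbb{Q}(V_4)\oplus\mathbb{Q}(\mathbb{Z}_4)^{\oplus3}\oplus\mathbb{Q}^{\oplus2}\oplus\mathbb{Q},$$ where $\mathbb{Q}(V_4)$ and $\mathbb{Q}(\mathbb{Z}_4)$ are the rational group algebras. -/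

import Mathlib

open scoped TensorProduct

noncomputable section

namespace GliderQ8

/-! ### Glider representations -/

/-- A glider representation over `ℂ` for the chain of subgroups `H 0 ⊆ H 1 ⊆ ...` of `G`: a
`ℂG`-module `Ω` with a descending chain of subspaces `Ω ⊇ M 0 ⊇ M 1 ⊇ ...` such that
`(H i) (M j) ⊆ M (j - i)` for `i ≤ j`.  (As `H i` is a subgroup, it then also maps
`(H i) (M j)` into `M 0`, that is, `(H i) (M j) ⊆ (M i)^*`.) -/
structure Glider {G : Type} [Group G] (H : ℕ → Subgroup G) : Type 1 where
  Ω : Type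
  [addCommGroup : AddCommGroup Ω]
  [module : Module ℂ Ω]
  ρ : Representation ℂ G Ω
  M : ℕ → Submodule ℂ Ω
  antitone : Antitone M
  act : ∀ i j, i ≤ j → ∀ g ∈ H i, ∀ m ∈ M j, ρ g m ∈ M (j - i)

attribute [instance] Glider.addCommGroup Glider.module

namespace Glider

variable {G : Type} [Group G] {H : ℕ → Subgroup G}

/-- The body: the intersection of the chain. -/
def body (A : Glider H) : Submodule ℂ A.Ω := ⨅ n, A.M n

/-- Essential length `e`: the chain reaches its body exactly at step `e + 1`. -/
def HasEssentialLength (A : Glider H) (e : ℕ) : Prop :=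
  A.M (e + 1) < A.M e ∧ A.M (e + 1) = A.body

/-- A chain of subspaces of the `M n` that is itself a glider for the same action. -/
structure IsSubglider (A : Glider H) (N : ℕ → Submodule ℂ A.Ω) : Prop where
  le : ∀ n, N n ≤ A.M n
  antitone : Antitone N
  act : ∀ i j, i ≤ j → ∀ g ∈ H i, ∀ m ∈ N j, A.ρ g m ∈ N (j - i)

/-- The three kinds of trivial subgliders of glider theory: `N` reaches its body before `M` does,
`N` vanishes before `M` does, or `N` is obtained from `M` by a reindexing `n ↦ α n` with `α` and
`n ↦ α n - n` monotone. -/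
def IsTrivialSub (A : Glider H) (N : ℕ → Submodule ℂ A.Ω) : Prop :=
  (∃ n, N n = (⨅ k, N k) ∧ A.M n ≠ A.body) ∨
  (∃ n, N n = ⊥ ∧ A.M n ≠ ⊥) ∨
  (∃ α : ℕ → ℕ, Monotone α ∧ (∀ n, N n = A.M (α n)) ∧
    ∀ m n, m ≤ n → (α m : ℤ) - m ≤ (α n : ℤ) - n)

/-- A nonzero glider is irreducible if all its subgliders are trivial. -/
def Irreducible (A : Glider H) : Prop :=
  A.M 0 ≠ ⊥ ∧ ∀ N, A.IsSubglider N → A.IsTrivialSub N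

/-- Isomorphism of gliders: a linear isomorphism of `M 0` onto `M' 0` that matches the chains and
satisfies `f (g x) = g (f x)` for `x ∈ M n` and `g ∈ H n`, whenever `g x` lies in `M 0`
(which it does, so that `y` below exists). -/
def Iso (A B : Glider H) : Prop :=
  ∃ f : A.M 0 ≃ₗ[ℂ] B.M 0,
    (∀ n (x : A.M 0), (x : A.Ω) ∈ A.M n ↔ (f x : B.Ω) ∈ B.M n) ∧
    ∀ n, ∀ g ∈ H n, ∀ x y : A.M 0, (x : A.Ω) ∈ A.M n → (y : A.Ω) = A.ρ g x →
      (f y : B.Ω) = B.ρ g (f x)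

/-- The tensor product of gliders: `Ω ⊗ Ω' ⊇ M 0 ⊗ M' 0 ⊇ M 1 ⊗ M' 1 ⊇ ...`, with diagonal
action of `G`. -/
def tensor (A B : Glider H) : Glider H where
  Ω := A.Ω ⊗[ℂ] B.Ω
  ρ := A.ρ.tprod B.ρ
  M n := Submodule.map₂ (TensorProduct.mk ℂ A.Ω B.Ω) (A.M n) (B.M n)
  antitone _ _ h := Submodule.map₂_le_map₂ (A.antitone h) (B.antitone h)
  act i j hij g hg m hm := by
    have hle : Submodule.map₂ (TensorProduct.mk ℂ A.Ω B.Ω) (A.M j) (B.M j) ≤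
        (Submodule.map₂ (TensorProduct.mk ℂ A.Ω B.Ω) (A.M (j - i)) (B.M (j - i))).comap
          ((A.ρ.tprod B.ρ) g) := by
      rw [Submodule.map₂_le]
      intro x hx y hy
      simpa using Submodule.apply_mem_map₂ (TensorProduct.mk ℂ A.Ω B.Ω)
        (A.act i j hij g hg x hx) (B.act i j hij g hg y hy)
    exact hle hm

theorem Iso.refl (A : Glider H) : Iso A A :=
  ⟨LinearEquiv.refl ℂ _, fun _ _ => Iff.rfl, fun _ _ _ _ _ _ h => h⟩

theorem Iso.symm {A B : Glider H} (h : Iso A B) : Iso B A := by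
  obtain ⟨f, h1, h2⟩ := h
  refine ⟨f.symm, fun n x => by rw [h1 n (f.symm x), f.apply_symm_apply], ?_⟩
  intro n g hg x y hx hy
  have hx' : ((f.symm x : A.M 0) : A.Ω) ∈ A.M n := by rwa [h1, f.apply_symm_apply]
  have hm : A.ρ g (f.symm x : A.M 0) ∈ A.M 0 := by
    simpa using A.act n n le_rfl g hg _ hx'
  have := h2 n g hg (f.symm x) ⟨_, hm⟩ hx' rfl
  rw [f.apply_symm_apply, ← hy] at this
  have h3 : f ⟨_, hm⟩ = y := Subtype.ext this
  rw [← h3, f.symm_apply_apply]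

theorem Iso.trans {A B C : Glider H} (h : Iso A B) (h' : Iso B C) : Iso A C := by
  obtain ⟨f, h1, h2⟩ := h
  obtain ⟨f', h1', h2'⟩ := h'
  refine ⟨f.trans f', fun n x => by rw [h1, h1']; rfl, ?_⟩
  intro n g hg x y hx hy
  exact h2' n g hg (f x) (f y) ((h1 n x).1 hx) (h2 n g hg x y hx hy)

end Glider

/-! ### The generalized character ring for the chain `1 ⊂ G` -/

/-- The chain `1 ⊂ G`. -/
def chain (G : Type) [Group G] : ℕ → Subgroup G
  | 0 => ⊥
  | _ + 1 => ⊤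

section OneStep

variable {G : Type} [Group G]

/-- The chain `ℂG L ⊇ L ⊇ 0 ⊇ ...` generated by a subspace `L` of a representation. -/
def genChain {Ω : Type} [AddCommGroup Ω] [Module ℂ Ω] (ρ : Representation ℂ G Ω)
    (L : Submodule ℂ Ω) : ℕ → Submodule ℂ Ω
  | 0 => ⨆ g : G, L.map (ρ g)
  | 1 => L
  | _ + 2 => ⊥

theorem genChain_antitone {Ω : Type} [AddCommGroup Ω] [Module ℂ Ω] (ρ : Representation ℂ G Ω)
    (L : Submodule ℂ Ω) : Antitone (genChain ρ L) := by
  refine antitone_nat_of_succ_le fun n => ?_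
  match n with
  | 0 =>
    refine le_trans (le_of_eq ?_) (le_iSup (fun g : G => L.map (ρ g)) 1)
    rw [map_one]
    exact (Submodule.map_id L).symm
  | 1 => exact bot_le
  | n + 2 => exact le_rfl

theorem genChain_act {Ω : Type} [AddCommGroup Ω] [Module ℂ Ω] (ρ : Representation ℂ G Ω)
    (L : Submodule ℂ Ω) (i j : ℕ) (hij : i ≤ j) (g : G) (hg : g ∈ chain G i) (m : Ω)
    (hm : m ∈ genChain ρ L j) : ρ g m ∈ genChain ρ L (j - i) := by
  obtain _ | i := i
  · have : g = 1 := by simpa [chain] using hg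
    subst this
    simpa using hm
  · obtain _ | _ | j := j
    · omega
    · obtain rfl : i = 0 := by omega
      exact Submodule.mem_iSup_of_mem g (Submodule.mem_map_of_mem hm)
    · have : m = 0 := (Submodule.mem_bot ℂ).1 hm
      subst this
      rw [map_zero]
      exact Submodule.zero_mem _

theorem genChain_iInf {Ω : Type} [AddCommGroup Ω] [Module ℂ Ω] (ρ : Representation ℂ G Ω)
    (L : Submodule ℂ Ω) : (⨅ n, genChain ρ L n) = ⊥ :=
  le_bot_iff.1 (iInf_le (genChain ρ L) 2)

theorem genChain_zero_ne {Ω : Type} [AddCommGroup Ω] [Module ℂ Ω] (ρ : Representation ℂ G Ω)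
    {L : Submodule ℂ Ω} (hL : L ≠ ⊥) : genChain ρ L 0 ≠ ⊥ := by
  intro h
  have : L ≤ genChain ρ L 0 := genChain_antitone ρ L (Nat.zero_le 1)
  rw [h, le_bot_iff] at this
  exact hL this

theorem genChain_span_zero {Ω : Type} [AddCommGroup Ω] [Module ℂ Ω] (ρ : Representation ℂ G Ω)
    (v : Ω) : genChain ρ (Submodule.span ℂ {v}) 0 =
      Submodule.span ℂ (Set.range fun g => ρ g v) := by
  change (⨆ g : G, (Submodule.span ℂ {v}).map (ρ g)) = _
  rw [← Set.iUnion_singleton_eq_range, Submodule.span_iUnion]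
  refine iSup_congr fun g => ?_
  rw [Submodule.map_span, Set.image_singleton]

/-- The glider `ℂG L ⊇ L ⊇ 0 ⊇ ...` generated by a subspace `L` of a representation. -/
def generated {Ω : Type} [AddCommGroup Ω] [Module ℂ Ω] (ρ : Representation ℂ G Ω)
    (L : Submodule ℂ Ω) : Glider (chain G) where
  Ω := Ω
  ρ := ρ
  M := genChain ρ L
  antitone := genChain_antitone ρ L
  act := genChain_act ρ L

/-- The irreducible gliders of essential length `1` with zero body. -/
def IsBasic (A : Glider (chain G)) : Prop :=
  A.Irreducible ∧ A.body = ⊥ ∧ A.HasEssentialLength 1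

theorem eq_genChain {Ω : Type} [AddCommGroup Ω] [Module ℂ Ω] (ρ : Representation ℂ G Ω)
    (v : Ω) (N : ℕ → Submodule ℂ Ω) (hle : ∀ n, N n ≤ genChain ρ (Submodule.span ℂ {v}) n)
    (hact : ∀ g : G, ∀ m ∈ N 1, ρ g m ∈ N 0) (h1 : N 1 ≠ ⊥) (n : ℕ) :
    N n = genChain ρ (Submodule.span ℂ {v}) n := by
  have hN1 : N 1 = Submodule.span ℂ {v} := by
    refine le_antisymm (hle 1) ?_
    obtain ⟨w, hw, hw0⟩ := (Submodule.ne_bot_iff _).1 h1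
    obtain ⟨c, rfl⟩ := Submodule.mem_span_singleton.1 (hle 1 hw)
    have hc : c ≠ 0 := by rintro rfl; simp at hw0
    rw [Submodule.span_singleton_le_iff_mem]
    simpa [smul_smul, hc] using (N 1).smul_mem c⁻¹ hw
  match n with
  | 0 =>
    refine le_antisymm (hle 0) (iSup_le fun g => ?_)
    rintro _ ⟨x, hx, rfl⟩
    rw [SetLike.mem_coe, ← hN1] at hx
    exact hact g x hx
  | 1 => exact hN1
  | n + 2 => exact le_bot_iff.1 (hle (n + 2))

theorem isBasic_generated {Ω : Type} [AddCommGroup Ω] [Module ℂ Ω] (ρ : Representation ℂ G Ω)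
    (v : Ω) (hv : v ≠ 0) : IsBasic (generated ρ (Submodule.span ℂ {v})) := by
  have hL : Submodule.span ℂ {v} ≠ ⊥ := by simpa using hv
  refine ⟨⟨genChain_zero_ne ρ hL, fun N hN => ?_⟩, genChain_iInf ρ _, bot_lt_iff_ne_bot.2 hL,
    (genChain_iInf ρ _).symm⟩
  by_cases h1 : N 1 = ⊥
  · exact Or.inr (Or.inl ⟨1, h1, hL⟩)
  · exact Or.inr (Or.inr ⟨id, monotone_id,
      eq_genChain ρ v N hN.le (hN.act 1 1 le_rfl · trivial) h1, fun m n _ => by simp⟩)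

theorem IsBasic.exists_gen {A : Glider (chain G)} (hA : IsBasic A) :
    ∃ v : A.Ω, v ≠ 0 ∧ A.M = genChain A.ρ (Submodule.span ℂ {v}) := by
  obtain ⟨⟨_, hirr⟩, hbody, hlt, h2⟩ := hA
  have h2 : A.M 2 = ⊥ := h2.trans hbody
  have hlt : ⊥ < A.M 1 := lt_of_le_of_lt bot_le hlt
  obtain ⟨v, hv, hv0⟩ := (Submodule.ne_bot_iff _).1 (bot_lt_iff_ne_bot.1 hlt)
  have hL : Submodule.span ℂ {v} ≠ ⊥ := by simpa using hv0
  have hle1 : Submodule.span ℂ {v} ≤ A.M 1 := by simpa using hv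
  have hA0 : ∀ n, 2 ≤ n → A.M n = ⊥ := fun n hn => le_bot_iff.1 (h2 ▸ A.antitone hn)
  have hsub : A.IsSubglider (genChain A.ρ (Submodule.span ℂ {v})) := by
    refine ⟨fun n => ?_, genChain_antitone _ _, genChain_act _ _⟩
    match n with
    | 0 =>
      refine iSup_le fun g => ?_
      rintro _ ⟨x, hx, rfl⟩
      exact A.act 1 1 le_rfl g trivial x (hle1 hx)
    | 1 => exact hle1
    | n + 2 => exact bot_le
  have hne : ∀ n, A.M n ≠ ⊥ → genChain A.ρ (Submodule.span ℂ {v}) n ≠ ⊥ := by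
    intro n hn
    match n with
    | 0 => exact genChain_zero_ne A.ρ hL
    | 1 => exact hL
    | n + 2 => exact absurd (hA0 (n + 2) (by omega)) hn
  obtain ⟨n, hn, hn'⟩ | ⟨n, hn, hn'⟩ | ⟨α, _, hα, hα'⟩ := hirr _ hsub
  · rw [hbody] at hn'
    rw [genChain_iInf] at hn
    exact absurd hn (hne n hn')
  · exact absurd hn (hne n hn')
  · have hα1 : α 1 ≤ 1 := by
      by_contra hlt
      exact hL ((hα 1).trans (hA0 (α 1) (by omega)))
    have h01 := hα' 0 1 (Nat.zero_le 1)
    have hα0 : α 0 = 0 := by push_cast at h01; omega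
    have hα1' : α 1 = 1 := by push_cast at h01; omega
    refine ⟨v, hv0, funext fun n => ?_⟩
    match n with
    | 0 => rw [hα 0, hα0]
    | 1 => rw [hα 1, hα1']
    | n + 2 => exact hA0 (n + 2) (by omega)

/-- The subglider of `A` generated by its degree one layer, `ℂG (M 1) ⊇ M 1 ⊇ 0 ⊇ ...`. -/
def core (A : Glider (chain G)) : Glider (chain G) := generated A.ρ (A.M 1)

theorem tmul_ne {V W : Type} [AddCommGroup V] [Module ℂ V] [AddCommGroup W] [Module ℂ W]
    {v : V} {w : W} (hv : v ≠ 0) (hw : w ≠ 0) : v ⊗ₜ[ℂ] w ≠ 0 := by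
  intro h
  obtain ⟨f, hf⟩ := Module.Projective.exists_dual_ne_zero ℂ hv
  obtain ⟨f', hf'⟩ := Module.Projective.exists_dual_ne_zero ℂ hw
  have h0 := congrArg (TensorProduct.lift (f.smulRight f')) h
  simp [hf, hf'] at h0

theorem core_tensor_eq {A B : Glider (chain G)} {v : A.Ω} {w : B.Ω}
    (hv : A.M = genChain A.ρ (Submodule.span ℂ {v}))
    (hw : B.M = genChain B.ρ (Submodule.span ℂ {w})) :
    core (A.tensor B) = generated (A.ρ.tprod B.ρ) (Submodule.span ℂ {v ⊗ₜ[ℂ] w}) := by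
  have h : Submodule.map₂ (TensorProduct.mk ℂ A.Ω B.Ω) (A.M 1) (B.M 1) =
      Submodule.span ℂ {v ⊗ₜ[ℂ] w} := by
    rw [hv, hw]
    change Submodule.map₂ _ (Submodule.span ℂ {v}) (Submodule.span ℂ {w}) = _
    rw [Submodule.map₂_span_span]
    simp
  exact congrArg (generated (A.ρ.tprod B.ρ)) h

theorem isBasic_core_tensor {A B : Glider (chain G)} (hA : IsBasic A) (hB : IsBasic B) :
    IsBasic (core (A.tensor B)) := by
  obtain ⟨v, hv0, hv⟩ := hA.exists_gen
  obtain ⟨w, hw0, hw⟩ := hB.exists_gen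
  rw [core_tensor_eq hv hw]
  exact isBasic_generated _ _ (tmul_ne hv0 hw0)

/-- A linear map matching the orbits of two vectors. -/
def Link {V W : Type} [AddCommGroup V] [Module ℂ V] [AddCommGroup W] [Module ℂ W]
    (ρ : Representation ℂ G V) (v : V) (τ : Representation ℂ G W) (w : W) : Prop :=
  ∃ φ : V →ₗ[ℂ] W, ∀ g, φ (ρ g v) = τ g w

theorem iso_of_link {A B : Glider (chain G)} {v : A.Ω} {w : B.Ω}
    (hv : A.M = genChain A.ρ (Submodule.span ℂ {v}))
    (hw : B.M = genChain B.ρ (Submodule.span ℂ {w}))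
    (h : Link A.ρ v B.ρ w) (h' : Link B.ρ w A.ρ v) : A.Iso B := by
  obtain ⟨φ, hφ⟩ := h
  obtain ⟨ψ, hψ⟩ := h'
  have hA0 : A.M 0 = Submodule.span ℂ (Set.range fun g => A.ρ g v) := by
    rw [hv, genChain_span_zero]
  have hB0 : B.M 0 = Submodule.span ℂ (Set.range fun g => B.ρ g w) := by
    rw [hw, genChain_span_zero]
  have hφ0 : ∀ x ∈ A.M 0, φ x ∈ B.M 0 := by
    change A.M 0 ≤ (B.M 0).comap φ
    rw [hA0, Submodule.span_le]
    rintro _ ⟨g, rfl⟩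
    rw [SetLike.mem_coe, Submodule.mem_comap, hφ, hB0]
    exact Submodule.subset_span ⟨g, rfl⟩
  have hψ0 : ∀ x ∈ B.M 0, ψ x ∈ A.M 0 := by
    change B.M 0 ≤ (A.M 0).comap ψ
    rw [hB0, Submodule.span_le]
    rintro _ ⟨g, rfl⟩
    rw [SetLike.mem_coe, Submodule.mem_comap, hψ, hA0]
    exact Submodule.subset_span ⟨g, rfl⟩
  have hψφ : ∀ x ∈ A.M 0, ψ (φ x) = x := by
    change A.M 0 ≤ LinearMap.eqLocus (ψ ∘ₗ φ) LinearMap.id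
    rw [hA0, Submodule.span_le]
    rintro _ ⟨g, rfl⟩
    simp [hφ, hψ]
  have hφψ : ∀ x ∈ B.M 0, φ (ψ x) = x := by
    change B.M 0 ≤ LinearMap.eqLocus (φ ∘ₗ ψ) LinearMap.id
    rw [hB0, Submodule.span_le]
    rintro _ ⟨g, rfl⟩
    simp [hφ, hψ]
  have hact : ∀ g, ∀ x ∈ A.M 0, φ (A.ρ g x) = B.ρ g (φ x) := by
    intro g
    change A.M 0 ≤ LinearMap.eqLocus (φ ∘ₗ A.ρ g) (B.ρ g ∘ₗ φ)
    rw [hA0, Submodule.span_le]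
    rintro _ ⟨k, rfl⟩
    have h1 : A.ρ g (A.ρ k v) = A.ρ (g * k) v := by simp
    have h2 : B.ρ g (B.ρ k w) = B.ρ (g * k) w := by simp
    change φ (A.ρ g (A.ρ k v)) = B.ρ g (φ (A.ρ k v))
    rw [h1, hφ, hφ, h2]
  have hφv : φ v = w := by simpa using hφ 1
  have hψw : ψ w = v := by simpa using hψ 1
  refine ⟨LinearEquiv.ofLinearMap (φ.restrict hφ0) (ψ.restrict hψ0) ?_ ?_, ?_, ?_⟩
  · ext x
    exact hφψ x x.2
  · ext x
    exact hψφ x x.2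
  · intro n x
    change (x : A.Ω) ∈ A.M n ↔ φ x ∈ B.M n
    have key : φ x ∈ B.M 1 ↔ (x : A.Ω) ∈ A.M 1 := by
      have hA1 : A.M 1 = Submodule.span ℂ {v} := congrFun hv 1
      have hB1 : B.M 1 = Submodule.span ℂ {w} := congrFun hw 1
      rw [hA1, hB1, Submodule.mem_span_singleton, Submodule.mem_span_singleton]
      refine exists_congr fun c => ⟨fun h => ?_, fun h => ?_⟩
      · rw [← hψφ x x.2, ← h, map_smul, hψw]
      · rw [← h, map_smul, hφv]
    match n with
    | 0 => exact ⟨fun h => hφ0 _ h, fun _ => x.2⟩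
    | 1 => exact key.symm
    | n + 2 =>
      have ha : A.M (n + 2) = ⊥ := by rw [hv]; rfl
      have hb : B.M (n + 2) = ⊥ := by rw [hw]; rfl
      rw [ha, hb, Submodule.mem_bot, Submodule.mem_bot]
      refine ⟨fun h => by rw [h, map_zero], fun h => ?_⟩
      rw [← hψφ x x.2, h, map_zero]
  · intro n g _ x y _ hy
    change φ y = B.ρ g (φ x)
    rw [hy]
    exact hact g x x.2

theorem Link.smul {V W : Type} [AddCommGroup V] [Module ℂ V] [AddCommGroup W] [Module ℂ W]
    {ρ : Representation ℂ G V} {v : V} {τ : Representation ℂ G W} {w : W}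
    (h : Link ρ v τ w) (c : ℂ) : Link ρ v τ (c • w) := by
  obtain ⟨φ, hφ⟩ := h
  exact ⟨c • φ, fun g => by simp [hφ]⟩

theorem link_gen_of_iso {A B : Glider (chain G)} {v : A.Ω} {w : B.Ω} (hv0 : v ≠ 0)
    (hv : A.M = genChain A.ρ (Submodule.span ℂ {v}))
    (hw : B.M = genChain B.ρ (Submodule.span ℂ {w})) (h : A.Iso B) : Link A.ρ v B.ρ w := by
  obtain ⟨f, h1, h2⟩ := h
  have hv1 : v ∈ A.M 1 := by rw [hv]; exact Submodule.mem_span_singleton_self v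
  have hv00 : ∀ g, A.ρ g v ∈ A.M 0 := fun g => A.act 1 1 le_rfl g trivial v hv1
  have hvv : v ∈ A.M 0 := by simpa using hv00 1
  obtain ⟨φ, hφ⟩ := LinearMap.exists_extend ((B.M 0).subtype ∘ₗ f.toLinearMap)
  have hL : Link A.ρ v B.ρ (f ⟨v, hvv⟩) := by
    refine ⟨φ, fun g => ?_⟩
    rw [← h2 1 g trivial ⟨v, hvv⟩ ⟨_, hv00 g⟩ hv1 rfl]
    exact congrArg (fun l => l ⟨_, hv00 g⟩) hφ
  have hf1 : (f ⟨v, hvv⟩ : B.Ω) ∈ Submodule.span ℂ {w} := by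
    have hB1 : B.M 1 = Submodule.span ℂ {w} := congrFun hw 1
    rw [← hB1]
    exact (h1 1 ⟨v, hvv⟩).1 hv1
  obtain ⟨c, hc⟩ := Submodule.mem_span_singleton.1 hf1
  have hc0 : c ≠ 0 := by
    rintro rfl
    rw [zero_smul] at hc
    have hz : f ⟨v, hvv⟩ = 0 := Subtype.ext hc.symm
    have := f.map_eq_zero_iff.1 hz
    exact hv0 (congrArg Subtype.val this)
  have := hL.smul c⁻¹
  rwa [← hc, smul_smul, inv_mul_cancel₀ hc0, one_smul] at this

theorem Link.tensor {V W V' W' : Type} [AddCommGroup V] [Module ℂ V] [AddCommGroup W]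
    [Module ℂ W] [AddCommGroup V'] [Module ℂ V'] [AddCommGroup W'] [Module ℂ W']
    {ρ : Representation ℂ G V} {v : V} {τ : Representation ℂ G W} {w : W}
    {ρ' : Representation ℂ G V'} {v' : V'} {τ' : Representation ℂ G W'} {w' : W'}
    (h : Link ρ v τ w) (h' : Link ρ' v' τ' w') :
    Link (ρ.tprod ρ') (v ⊗ₜ v') (τ.tprod τ') (w ⊗ₜ w') := by
  obtain ⟨φ, hφ⟩ := h
  obtain ⟨ψ, hψ⟩ := h'
  exact ⟨TensorProduct.map φ ψ, fun g => by simp [hφ, hψ]⟩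

variable (G) in
/-- Irreducible gliders of essential length `1` with zero body for the chain `1 ⊂ G`. -/
abbrev BasicGlider : Type 1 := {A : Glider (chain G) // IsBasic A}

instance BasicGlider.setoid : Setoid (BasicGlider G) where
  r A B := A.1.Iso B.1
  iseqv := ⟨fun A => Glider.Iso.refl A.1, Glider.Iso.symm, Glider.Iso.trans⟩

variable (G) in
/-- Isomorphism classes of irreducible gliders of essential length `1` with zero body; these
label the generalized characters `χ_M`. -/
def GliderClass : Type 1 := Quotient (BasicGlider.setoid (G := G))

/-- The class of the glider `ℂG v ⊇ ℂ v ⊇ 0 ⊇ ...`. -/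
def GliderClass.ofVec {Ω : Type} [AddCommGroup Ω] [Module ℂ Ω] (ρ : Representation ℂ G Ω)
    (v : Ω) (hv : v ≠ 0) : GliderClass G :=
  Quotient.mk _ ⟨_, isBasic_generated ρ v hv⟩

theorem GliderClass.exists_ofVec (x : GliderClass G) :
    ∃ (Ω : Type) (_ : AddCommGroup Ω) (_ : Module ℂ Ω) (ρ : Representation ℂ G Ω) (v : Ω)
      (hv : v ≠ 0), x = ofVec ρ v hv := by
  obtain ⟨⟨A, hA⟩, rfl⟩ := Quotient.exists_rep x
  obtain ⟨v, hv0, hv⟩ := hA.exists_gen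
  refine ⟨A.Ω, _, _, A.ρ, v, hv0, Quotient.sound ?_⟩
  exact iso_of_link (A := A) (B := generated A.ρ (Submodule.span ℂ {v})) hv rfl
    ⟨LinearMap.id, fun _ => rfl⟩ ⟨LinearMap.id, fun _ => rfl⟩

theorem GliderClass.ofVec_eq {V W : Type} [AddCommGroup V] [Module ℂ V] [AddCommGroup W]
    [Module ℂ W] {ρ : Representation ℂ G V} {v : V} {τ : Representation ℂ G W} {w : W}
    {hv : v ≠ 0} {hw : w ≠ 0} (h : Link ρ v τ w) (h' : Link τ w ρ v) :
    ofVec ρ v hv = ofVec τ w hw :=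
  Quotient.sound (iso_of_link (A := generated ρ (Submodule.span ℂ {v}))
    (B := generated τ (Submodule.span ℂ {w})) rfl rfl h h')

/-- The product `χ_M χ_N = χ_(M ⊗ N)`, where `χ_(ℂ ⊇ 0)` is set to zero: the glider `M ⊗ N` is
the fragment direct sum of the irreducible glider `core (M ⊗ N)` of essential length `1` and of
copies of the glider `ℂ ⊇ 0` (spanning a linear complement of `ℂG (M 1 ⊗ N 1)` in `M 0 ⊗ N 0`). -/
instance : Mul (GliderClass G) where
  mul := Quotient.map₂
    (fun A B => ⟨core (A.1.tensor B.1), isBasic_core_tensor A.2 B.2⟩) (by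
      rintro ⟨A, hA⟩ ⟨A', hA'⟩ h ⟨B, hB⟩ ⟨B', hB'⟩ h'
      obtain ⟨v, hv0, hv⟩ := hA.exists_gen
      obtain ⟨v', hv0', hv'⟩ := hA'.exists_gen
      obtain ⟨w, hw0, hw⟩ := hB.exists_gen
      obtain ⟨w', hw0', hw'⟩ := hB'.exists_gen
      change Glider.Iso A A' at h
      change Glider.Iso B B' at h'
      change Glider.Iso (core (A.tensor B)) (core (A'.tensor B'))
      rw [core_tensor_eq hv hw, core_tensor_eq hv' hw']
      exact iso_of_link
        (A := generated (A.ρ.tprod B.ρ) (Submodule.span ℂ {v ⊗ₜ[ℂ] w}))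
        (B := generated (A'.ρ.tprod B'.ρ) (Submodule.span ℂ {v' ⊗ₜ[ℂ] w'})) rfl rfl
        ((link_gen_of_iso hv0 hv hv' h).tensor (link_gen_of_iso hw0 hw hw' h'))
        ((link_gen_of_iso hv0' hv' hv h.symm).tensor (link_gen_of_iso hw0' hw' hw h'.symm)))

theorem GliderClass.ofVec_mul {V W : Type} [AddCommGroup V] [Module ℂ V] [AddCommGroup W]
    [Module ℂ W] (ρ : Representation ℂ G V) (v : V) (τ : Representation ℂ G W) (w : W)
    (hv : v ≠ 0) (hw : w ≠ 0) :
    ofVec ρ v hv * ofVec τ w hw = ofVec (ρ.tprod τ) (v ⊗ₜ w) (tmul_ne hv hw) := by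
  refine congrArg (Quotient.mk _) (Subtype.ext ?_)
  exact core_tensor_eq (A := generated ρ (Submodule.span ℂ {v}))
    (B := generated τ (Submodule.span ℂ {w})) rfl rfl

/-- The unit is the class of `ℂ ⊇ ℂ ⊇ 0 ⊇ ...` with the trivial representation. -/
instance : One (GliderClass G) where
  one := GliderClass.ofVec (Representation.trivial ℂ G ℂ) 1 one_ne_zero

instance : CommMonoid (GliderClass G) where
  mul_assoc x y z := by
    obtain ⟨_, _, _, ρ, v, hv, rfl⟩ := x.exists_ofVec
    obtain ⟨_, _, _, σ, w, hw, rfl⟩ := y.exists_ofVec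
    obtain ⟨_, _, _, τ, u, hu, rfl⟩ := z.exists_ofVec
    simp only [GliderClass.ofVec_mul]
    exact GliderClass.ofVec_eq
      ⟨(TensorProduct.assoc ℂ _ _ _).toLinearMap, fun g => by simp⟩
      ⟨(TensorProduct.assoc ℂ _ _ _).symm.toLinearMap, fun g => by simp⟩
  mul_comm x y := by
    obtain ⟨_, _, _, ρ, v, hv, rfl⟩ := x.exists_ofVec
    obtain ⟨_, _, _, σ, w, hw, rfl⟩ := y.exists_ofVec
    simp only [GliderClass.ofVec_mul]
    exact GliderClass.ofVec_eq
      ⟨(TensorProduct.comm ℂ _ _).toLinearMap, fun g => by simp⟩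
      ⟨(TensorProduct.comm ℂ _ _).toLinearMap, fun g => by simp⟩
  one_mul x := by
    obtain ⟨_, _, _, ρ, v, hv, rfl⟩ := x.exists_ofVec
    refine (GliderClass.ofVec_mul _ _ _ _ _ _).trans ?_
    exact GliderClass.ofVec_eq
      ⟨(TensorProduct.lid ℂ _).toLinearMap, fun g => by simp⟩
      ⟨(TensorProduct.lid ℂ _).symm.toLinearMap, fun g => by simp⟩
  mul_one x := by
    obtain ⟨_, _, _, ρ, v, hv, rfl⟩ := x.exists_ofVec
    refine (GliderClass.ofVec_mul _ _ _ _ _ _).trans ?_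
    exact GliderClass.ofVec_eq
      ⟨(TensorProduct.rid ℂ _).toLinearMap, fun g => by simp⟩
      ⟨(TensorProduct.rid ℂ _).symm.toLinearMap, fun g => by simp⟩

variable (G) in
/-- The algebra `ℚ(G̃) = ℚ ⊗ R(G̃)` of the generalized character ring of `G` with chain `1 ⊂ G`
(modulo the character of `ℂ ⊇ 0`): free over `ℚ` on the generalized characters of the irreducible
gliders of essential length `1` with zero body, with `χ_M χ_N = χ_(M ⊗ N)`. -/
abbrev CharAlg : Type 1 := MonoidAlgebra ℚ (GliderClass G)

open Classical in
/-- The generalized character of `ℂG v ⊇ ℂ v ⊇ 0 ⊇ ...` (zero if `v = 0`). -/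
def chi {Ω : Type} [AddCommGroup Ω] [Module ℂ Ω] (ρ : Representation ℂ G Ω) (v : Ω) :
    CharAlg G :=
  if hv : v ≠ 0 then MonoidAlgebra.of ℚ _ (GliderClass.ofVec ρ v hv) else 0

end OneStep

/-! ### The Klein four-group and the quaternion group -/

/-- The Klein four-group `V₄ = {1, a, b, c}`, with `a = (1, 0)`, `b = (0, 1)`, `c = (1, 1)`. -/
abbrev V4 : Type := Multiplicative (ZMod 2 × ZMod 2)

/-- The irreducible character of `V₄` with label `x`: the trivial one for `x = 1`, otherwise the
nontrivial one with kernel `{1, x}`.  It is multiplicative in `x` as well. -/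
def linChar (x : V4) : V4 →* ℤˣ where
  toFun y := if x.toAdd.1 * y.toAdd.2 + x.toAdd.2 * y.toAdd.1 = 0 then 1 else -1
  map_one' := by revert x; decide
  map_mul' := by revert x; decide

/-- The direct sum of the four one-dimensional representations `T_x` of `V₄`. -/
def repV4 : Representation ℂ V4 (V4 → ℂ) where
  toFun y :=
    { toFun := fun f x => (((linChar x y : ℤˣ) : ℤ) : ℂ) * f x
      map_add' := fun f f' => by ext x; simp [mul_add]
      map_smul' := fun c f => by ext x; simp [mul_left_comm] }
  map_one' := by ext; simp
  map_mul' y y' := by ext; simp [mul_assoc]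

/-- The quaternion group, with `i = a 1`, `j = xa 0`, `k = i j` in Mathlib's notation. -/
abbrev Q8 : Type := QuaternionGroup 2

/-- The quotient map of `Q₈` by its centre `{1, -1}`: `i ↦ a`, `j ↦ b`, `k ↦ c`. -/
def toV4 : Q8 →* V4 where
  toFun
    | .a m => Multiplicative.ofAdd ((m.val : ZMod 2), 0)
    | .xa m => Multiplicative.ofAdd ((m.val : ZMod 2), 1)
  map_one' := by decide
  map_mul' := by decide

def matI : Matrix (Fin 2) (Fin 2) ℂ := !![0, Complex.I; Complex.I, 0]

def matJ : Matrix (Fin 2) (Fin 2) ℂ := !![-Complex.I, 0; 0, Complex.I]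

theorem matI_sq : matI ^ 2 = -1 := by
  rw [pow_two]
  ext i j; fin_cases i <;> fin_cases j <;> simp [matI]

theorem matJ_mul : matJ * matJ = matI ^ 2 := by
  rw [pow_two]
  ext i j; fin_cases i <;> fin_cases j <;> simp [matI, matJ]

theorem matI_mul_matJ : matI * matJ = matJ * matI ^ 3 := by
  rw [pow_succ, matI_sq]
  ext i j; fin_cases i <;> fin_cases j <;> simp [matJ, matI]

/-- The two-dimensional irreducible representation `U` of `Q₈` in matrix form, with
`i ↦ matI` and `j ↦ matJ`. -/
def matU : Q8 →* Matrix (Fin 2) (Fin 2) ℂ where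
  toFun
    | .a m => matI ^ m.val
    | .xa m => matJ * matI ^ m.val
  map_one' := by rfl
  map_mul' := by
    have h4 : matI ^ 4 = 1 := by
      rw [show (4 : ℕ) = 2 * 2 from rfl, pow_mul, matI_sq]; simp
    have hv (n : ZMod (2 * 2)) (k : ℕ) (h : k % 4 = n.val) : matI ^ k = matI ^ n.val := by
      rw [← h, ← Nat.div_add_mod k 4, pow_add, pow_mul, h4]; simp
    have hIJ (k : ℕ) : matI ^ k * matJ = matJ * matI ^ (3 * k) := by
      induction k with
      | zero => simp
      | succ k ih => rw [pow_succ, mul_assoc, matI_mul_matJ, ← mul_assoc, ih, mul_assoc,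
          ← pow_add]; rfl
    rintro (m | m) (n | n)
    · change matI ^ (m + n).val = matI ^ m.val * matI ^ n.val
      rw [← pow_add]
      exact (hv _ _ (by revert m n; decide)).symm
    · change matJ * matI ^ (n - m).val = matI ^ m.val * (matJ * matI ^ n.val)
      rw [← mul_assoc, hIJ, mul_assoc, ← pow_add]
      exact congrArg _ (hv _ _ (by revert m n; decide)).symm
    · change matJ * matI ^ (m + n).val = matJ * matI ^ m.val * matI ^ n.val
      rw [mul_assoc, ← pow_add]
      exact congrArg _ (hv _ _ (by revert m n; decide)).symm
    · change matI ^ (2 + n - m).val = matJ * matI ^ m.val * (matJ * matI ^ n.val)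
      rw [mul_assoc, ← mul_assoc (matI ^ _), hIJ, mul_assoc, ← pow_add, ← mul_assoc, matJ_mul,
        ← pow_add]
      exact (hv _ _ (by revert m n; decide)).symm

/-- The two-dimensional irreducible representation `U` of `Q₈`. -/
def repU : Representation ℂ Q8 (Fin 2 → ℂ) :=
  (Matrix.toLinAlgEquiv' : Matrix (Fin 2) (Fin 2) ℂ ≃ₐ[ℂ] _).toMonoidHom.comp matU

/-- The representation `T_1 ⊕ T_i ⊕ T_j ⊕ T_k ⊕ U ⊕ U` of `Q₈`; the one-dimensional
representations are inflated from `V₄`, so that `T_1, T_i, T_j, T_k` have labels `1, a, b, c`. -/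
def repQ8 : Representation ℂ Q8 ((V4 → ℂ) × (Fin 2 → ℂ) × (Fin 2 → ℂ)) :=
  Representation.prod (repV4.comp toV4) (Representation.prod repU repU)

/-- The vector `∑ t_x`, with `x` in `A`. -/
def indVec (A : Finset V4) : V4 → ℂ := fun x => if x ∈ A then 1 else 0

/-- `χ_A` in `ℚ(Ṽ₄)`: the character of `⨁_{x ∈ A} T_x ⊇ ℂ (∑_{x ∈ A} t_x)`. -/
def chiV4 (A : Finset V4) : CharAlg V4 := chi repV4 (indVec A)

/-- `χ_(A, ∅)` in `ℚ(Q̃₈)`: the character of `⨁_{x ∈ A} T_x ⊇ ℂ (∑_{x ∈ A} t_x)`. -/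
def chiEmpty (A : Finset V4) : CharAlg Q8 := chi repQ8 (indVec A, 0, 0)

/-- `χ_(A, [l : m])` in `ℚ(Q̃₈)`, for `(l, m) ≠ 0`: the character of
`⨁_{x ∈ A} T_x ⊕ U ⊇ ℂ (∑_{x ∈ A} t_x + l e₁ + m e₂)`. -/
def chiPoint (A : Finset V4) (l m : ℂ) : CharAlg Q8 := chi repQ8 (indVec A, ![l, m], 0)

/-- `χ_(A, ∗)` in `ℚ(Q̃₈)`: the character of
`⨁_{x ∈ A} T_x ⊕ U ⊕ U ⊇ ℂ (∑_{x ∈ A} t_x + (e₁, e₂))`. -/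
def chiStar (A : Finset V4) : CharAlg Q8 := chi repQ8 (indVec A, ![1, 0], ![0, 1])

/-- `(l, m)` is nonzero and the point `[l : m]` of the projective line is generic, that is, none
of `[1:0], [0:1], [1:1], [1:-1], [1:i], [1:-i]`. -/
def IsGeneric (l m : ℂ) : Prop := l ≠ 0 ∧ m ≠ 0 ∧ m ^ 2 ≠ l ^ 2 ∧ m ^ 2 ≠ -l ^ 2

/-- The ideal `I'`, generated by the differences `χ_(∅, p) - χ_(∅, ∗)` for generic points `p` of
the projective line, and `χ_(A, p) - χ_(V₄, ∗)` for nonempty `A` and `p` a point of the projective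
line or `∗`. -/
def idealI : Ideal (CharAlg Q8) :=
  Ideal.span
    ({z | ∃ l m : ℂ, IsGeneric l m ∧ z = chiPoint ∅ l m - chiStar ∅} ∪
      {z | ∃ (A : Finset V4) (l m : ℂ), A.Nonempty ∧ (l, m) ≠ (0, 0) ∧
        z = chiPoint A l m - chiStar Finset.univ} ∪
      {z | ∃ A : Finset V4, A.Nonempty ∧ z = chiStar A - chiStar Finset.univ})

end GliderQ8

end

/-! For any finite group `G` with chain `1 ⊂ G`, the radical is determined by eigenvalues. A class
`s` has a generator `v`, unique up to scalar; the elements of `G` having `v` as an eigenvector form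
a subgroup `s.stab`, which acts on `v` by a linear character. The set `s.eigen` records exactly this
pair.

If a tensor `v ⊗ w` is an eigenvector of `g`, so are both factors. Hence for each subgroup `C` the
rule sending `s` to its character on `C`, or to zero if `C` does not act by scalars, is
multiplicative. It gives an algebra map `eigAlg C` to the rational group algebra of the character
group of `C`. The product `eigAlgPi` of these maps is surjective: on the classes `ind C χ` induced
from characters it is triangular for inclusion of subgroups. A dimension count then shows that its
kernel is `eigenSpan`, spanned by the differences `s - t` with `s.eigen = t.eigen`
(`mem_eigenSpan_iff`).

These differences are nilpotent (`isNilpotent_sub`). Put `C = s.stab`. Multiplying `s` or `t` by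
`ind C 1` gives the same `ind C χ` (`mul_ind_one`), while some power of each is a class induced from
`C` (`exists_pow_eq_ind`), so divisible by `ind C 1`. Modulo a prime, either `ind C 1` vanishes, and
then so do `s` and `t`, or it can be cancelled. So the kernel consists of nilpotents; as the target
is semisimple, the kernel is the Jacobson radical (`jacobson_eq_ker`).

For `Q₈`, isotypic projections put every generator in the form `(A, p, q)` (`exists_eq_model`).
Comparing eigenvalues shows that a difference in `eigenSpan` is inflated from `V₄` when `U` does not
occur, and lies in `I'` when it does (`jacobson_Q8`). The quotient is the product of the group
algebras attached to the subgroups of `Q₈`: the whole group, three cyclic groups of order four, the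
centre and the trivial group. -/

noncomputable section

namespace GliderQ8

/-! ### Characters by which subgroups act on generators -/

variable {G : Type} [Group G]

/-- The group of linear characters of a subgroup. -/
def CharGroup (C : Subgroup G) : Type := C →* ℂˣ

instance (C : Subgroup G) : CommGroup (CharGroup C) := inferInstanceAs (CommGroup (C →* ℂˣ))

instance (C : Subgroup G) [Finite G] : Finite (CharGroup C) :=
  inferInstanceAs (Finite (C →* ℂˣ))

namespace GliderClass

theorem links_of_ofVec_eq {V W : Type} [AddCommGroup V] [Module ℂ V] [AddCommGroup W]
    [Module ℂ W] {ρ : Representation ℂ G V} {v : V} {τ : Representation ℂ G W} {w : W}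
    {hv : v ≠ 0} {hw : w ≠ 0} (h : ofVec ρ v hv = ofVec τ w hw) :
    Link ρ v τ w ∧ Link τ w ρ v := by
  have hi : Glider.Iso (generated ρ (Submodule.span ℂ {v}))
    (generated τ (Submodule.span ℂ {w})) := Quotient.exact h
  exact ⟨link_gen_of_iso (A := generated ρ (Submodule.span ℂ {v}))
      (B := generated τ (Submodule.span ℂ {w})) hv rfl rfl hi,
    link_gen_of_iso (A := generated τ (Submodule.span ℂ {w}))
      (B := generated ρ (Submodule.span ℂ {v})) hw rfl rfl hi.symm⟩

/-- The pairs `(g, c)` such that the generator of the glider is an eigenvector of `g` with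
eigenvalue `c`. -/
def eigen (s : GliderClass G) : Set (G × ℂ) :=
  {p | ∃ (Ω : Type) (_ : AddCommGroup Ω) (_ : Module ℂ Ω) (ρ : Representation ℂ G Ω) (v : Ω)
      (hv : v ≠ 0), s = ofVec ρ v hv ∧ ρ p.1 v = p.2 • v}

/-- A link matches the two orbits, so it carries an eigenvector relation from one generator to the
other. Thus `eigen` can be tested on any representative. -/
theorem mem_eigen_ofVec {V : Type} [AddCommGroup V] [Module ℂ V] {ρ : Representation ℂ G V}
    {v : V} {hv : v ≠ 0} {g : G} {c : ℂ} : (g, c) ∈ (ofVec ρ v hv).eigen ↔ ρ g v = c • v := by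
  refine ⟨?_, fun h => ⟨V, _, _, ρ, v, hv, rfl, h⟩⟩
  rintro ⟨W, _, _, τ, w, hw, h, hc⟩
  obtain ⟨φ, hφ⟩ := (links_of_ofVec_eq h).2
  have h1 : φ w = v := by simpa using hφ 1
  rw [← hφ, hc, map_smul, h1]

/-- The generator of the glider is an eigenvector of the subgroup `C` with character `χ`. -/
def IsEig (C : Subgroup G) (χ : C →* ℂˣ) (s : GliderClass G) : Prop :=
  ∀ g : C, ((g : G), (χ g : ℂ)) ∈ s.eigen

theorem isEig_ofVec {V : Type} [AddCommGroup V] [Module ℂ V] {ρ : Representation ℂ G V}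
    {v : V} {hv : v ≠ 0} {C : Subgroup G} {χ : C →* ℂˣ} :
    IsEig C χ (ofVec ρ v hv) ↔ ∀ g : C, ρ g v = (χ g : ℂ) • v :=
  forall_congr' fun _ => mem_eigen_ofVec

theorem eigen_unique {s : GliderClass G} {g : G} {c d : ℂ} (hc : (g, c) ∈ s.eigen)
    (hd : (g, d) ∈ s.eigen) : c = d := by
  obtain ⟨_, _, _, ρ, v, hv, rfl⟩ := s.exists_ofVec
  rw [mem_eigen_ofVec] at hc hd
  exact smul_left_injective ℂ hv (hc.symm.trans hd)

theorem IsEig.unique {C : Subgroup G} {χ χ' : C →* ℂˣ} {s : GliderClass G} (h : IsEig C χ s)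
    (h' : IsEig C χ' s) : χ = χ' :=
  MonoidHom.ext fun g => Units.ext (eigen_unique (h g) (h' g))

/-- As `v ≠ 0`, each eigenvalue is unique; uniqueness makes the chosen eigenvalues multiplicative,
and they are units because `C` is a group. -/
theorem exists_isEig {C : Subgroup G} {s : GliderClass G}
    (h : ∀ g ∈ C, ∃ c, (g, c) ∈ s.eigen) : ∃ χ, IsEig C χ s := by
  obtain ⟨_, _, _, ρ, v, hv, rfl⟩ := s.exists_ofVec
  simp only [mem_eigen_ofVec] at h
  choose c hc using fun g : C => h g g.2
  have hinj := smul_left_injective ℂ hv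
  let χ : C →* ℂ :=
    { toFun := c
      map_one' := hinj (by simp [← hc])
      map_mul' := fun a b => hinj (by
        change c (a * b) • v = (c a * c b) • v
        rw [← hc, mul_comm, mul_smul, ← hc a, ← map_smul, ← hc b]
        simp) }
  refine ⟨χ.toHomUnits, isEig_ofVec.2 fun g => ?_⟩
  simp [χ, hc]

theorem IsEig.mul {C : Subgroup G} {χ χ' : C →* ℂˣ} {s t : GliderClass G} (h : IsEig C χ s)
    (h' : IsEig C χ' t) : IsEig C (χ * χ') (s * t) := by
  obtain ⟨_, _, _, ρ, v, hv, rfl⟩ := s.exists_ofVec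
  obtain ⟨_, _, _, τ, w, hw, rfl⟩ := t.exists_ofVec
  rw [ofVec_mul]
  rw [isEig_ofVec] at *
  intro g
  simp [h, h', TensorProduct.smul_tmul', smul_smul, mul_comm]

theorem isEig_one (C : Subgroup G) : IsEig C 1 (1 : GliderClass G) :=
  isEig_ofVec.2 fun g => by simp

/-- Contract the second tensor factor with a functional that does not vanish on `w'`. -/
theorem _root_.GliderQ8.eq_smul_of_tmul_eq {V W : Type} [AddCommGroup V] [Module ℂ V]
    [AddCommGroup W] [Module ℂ W] {v v' : V} {w w' : W} (hw' : w' ≠ 0)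
    {c : ℂ} (h : v' ⊗ₜ[ℂ] w' = c • (v ⊗ₜ[ℂ] w)) : ∃ d : ℂ, v' = d • v := by
  obtain ⟨f, hf⟩ := Module.Projective.exists_dual_ne_zero ℂ hw'
  have h1 := congrArg (TensorProduct.lift (LinearMap.lsmul ℂ V).flip ∘ₗ
    TensorProduct.map LinearMap.id f) h
  simp only [map_smul, LinearMap.comp_apply, TensorProduct.map_tmul, TensorProduct.lift.tmul,
    LinearMap.flip_apply, LinearMap.lsmul_apply, LinearMap.id_apply] at h1
  refine ⟨(f w')⁻¹ * c * f w, ?_⟩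
  rw [mul_assoc, mul_smul, mul_smul, ← h1, smul_smul, inv_mul_cancel₀ hf, one_smul]

/-- This is what makes `eigVal` multiplicative when one factor has value zero: a product cannot
acquire eigenvalues that a factor lacks. -/
theorem eigen_of_mul {s t : GliderClass G} {g : G} {c : ℂ} (h : (g, c) ∈ (s * t).eigen) :
    ∃ d, (g, d) ∈ s.eigen := by
  obtain ⟨_, _, _, ρ, v, hv, rfl⟩ := s.exists_ofVec
  obtain ⟨_, _, _, τ, w, hw, rfl⟩ := t.exists_ofVec
  rw [ofVec_mul, mem_eigen_ofVec] at h
  simp only [mem_eigen_ofVec]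
  refine eq_smul_of_tmul_eq (fun h0 => hw ?_) h
  simpa using congrArg (τ g⁻¹) h0

theorem exists_isEig_of_mul {C : Subgroup G} {χ : C →* ℂˣ} {s t : GliderClass G}
    (h : IsEig C χ (s * t)) : (∃ χ₁, IsEig C χ₁ s) ∧ ∃ χ₂, IsEig C χ₂ t :=
  ⟨exists_isEig fun g hg => eigen_of_mul (h ⟨g, hg⟩),
    exists_isEig fun g hg => eigen_of_mul (by rw [mul_comm]; exact h ⟨g, hg⟩)⟩

open Classical in
/-- The image of a class in the rational group algebra of the character group of a subgroup `C`:
the character by which `C` acts on the generator, or zero if that is not an eigenvector. -/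
def eigVal (C : Subgroup G) (s : GliderClass G) : MonoidAlgebra ℚ (CharGroup C) :=
  if h : ∃ χ, IsEig C χ s then MonoidAlgebra.of ℚ (CharGroup C) h.choose else 0

theorem eigVal_of_isEig {C : Subgroup G} {χ : C →* ℂˣ} {s : GliderClass G} (h : IsEig C χ s) :
    eigVal C s = MonoidAlgebra.of ℚ (CharGroup C) χ := by
  have hex : ∃ χ, IsEig C χ s := ⟨χ, h⟩
  rw [eigVal, dif_pos hex, hex.choose_spec.unique h]

theorem eigVal_of_not {C : Subgroup G} {s : GliderClass G} (h : ¬ ∃ χ, IsEig C χ s) :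
    eigVal C s = 0 := dif_neg h

theorem eigVal_congr {s t : GliderClass G} (h : s.eigen = t.eigen) (C : Subgroup G) :
    eigVal C s = eigVal C t := by
  have : ∀ χ, IsEig C χ s ↔ IsEig C χ t := fun χ => by simp only [IsEig, h]
  by_cases hs : ∃ χ, IsEig C χ s
  · obtain ⟨χ, hχ⟩ := hs
    rw [eigVal_of_isEig hχ, eigVal_of_isEig ((this χ).1 hχ)]
  · rw [eigVal_of_not hs, eigVal_of_not (by simpa only [this] using hs)]

/-- `eigVal` as a homomorphism of monoids. -/
def eigValHom (C : Subgroup G) : GliderClass G →* MonoidAlgebra ℚ (CharGroup C) where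
  toFun := eigVal C
  map_one' := (eigVal_of_isEig (isEig_one C)).trans (map_one _)
  map_mul' s t := by
    by_cases hs : ∃ χ, IsEig C χ s
    · by_cases ht : ∃ χ, IsEig C χ t
      · obtain ⟨χ, hχ⟩ := hs
        obtain ⟨χ', hχ'⟩ := ht
        rw [eigVal_of_isEig (hχ.mul hχ'), eigVal_of_isEig hχ, eigVal_of_isEig hχ']
        exact map_mul (MonoidAlgebra.of ℚ (CharGroup C)) χ χ'
      · rw [eigVal_of_not ht, mul_zero, eigVal_of_not]
        rintro ⟨χ, hχ⟩
        exact ht (exists_isEig_of_mul hχ).2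
    · rw [eigVal_of_not hs, zero_mul, eigVal_of_not]
      rintro ⟨χ, hχ⟩
      exact hs (exists_isEig_of_mul hχ).1

end GliderClass

/-! ### Induced gliders -/

variable (G) in
/-- The right regular representation on functions. -/
def funRep : Representation ℂ G (G → ℂ) where
  toFun g :=
    { toFun := fun f x => f (x * g)
      map_add' := fun _ _ => rfl
      map_smul' := fun _ _ => rfl }
  map_one' := by ext; simp
  map_mul' a b := by ext; simp [mul_assoc]

theorem funRep_apply (g : G) (f : G → ℂ) (x : G) : funRep G g f x = f (x * g) := rfl

open Classical in
/-- The extension by zero of a character of a subgroup. -/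
def extChar (C : Subgroup G) (χ : C →* ℂˣ) : G → ℂ :=
  fun g => if h : g ∈ C then χ ⟨g, h⟩ else 0

theorem extChar_coe {C : Subgroup G} (χ : C →* ℂˣ) (g : C) : extChar C χ g = χ g := by
  simp [extChar]

theorem extChar_of_notMem {C : Subgroup G} (χ : C →* ℂˣ) {g : G} (h : g ∉ C) :
    extChar C χ g = 0 := dif_neg h

theorem extChar_one {C : Subgroup G} (χ : C →* ℂˣ) : extChar C χ 1 = 1 := by
  simpa using extChar_coe χ 1

theorem extChar_mul_coe {C : Subgroup G} (χ : C →* ℂˣ) (x : G) (g : C) :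
    extChar C χ (x * g) = extChar C χ x * χ g := by
  by_cases hx : x ∈ C
  · lift x to C using hx
    rw [← Subgroup.coe_mul, extChar_coe, extChar_coe, map_mul, Units.val_mul]
  · rw [extChar_of_notMem χ hx, extChar_of_notMem, zero_mul]
    rwa [Subgroup.mul_mem_cancel_right _ g.2]

theorem extChar_ne_zero (C : Subgroup G) (χ : C →* ℂˣ) : extChar C χ ≠ 0 := fun h => by
  have := extChar_one χ
  simp [h] at this

namespace GliderClass

/-- The class of the glider induced from a character of a subgroup. -/
def ind (C : Subgroup G) (χ : C →* ℂˣ) : GliderClass G :=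
  ofVec (funRep G) (extChar C χ) (extChar_ne_zero C χ)

theorem isEig_ind (C : Subgroup G) (χ : C →* ℂˣ) : IsEig C χ (ind C χ) :=
  isEig_ofVec.2 fun g => funext fun x => by
    rw [funRep_apply, extChar_mul_coe, Pi.smul_apply, smul_eq_mul, mul_comm]

/-- Evaluate at `g⁻¹`: the translate takes the value `1` there, whereas the generator vanishes there
if `g ∉ C`. -/
theorem mem_of_eigen_ind {C : Subgroup G} {χ : C →* ℂˣ} {g : G} {c : ℂ}
    (h : (g, c) ∈ (ind C χ).eigen) : g ∈ C := by
  by_contra hg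
  have h1 := congrFun (mem_eigen_ofVec.1 h) g⁻¹
  have h2 : g⁻¹ ∉ C := by simpa using hg
  rw [funRep_apply, inv_mul_cancel, extChar_one, Pi.smul_apply, extChar_of_notMem χ h2,
    smul_zero] at h1
  exact one_ne_zero h1

theorem isEig_ind_iff {C D : Subgroup G} {χ : C →* ℂˣ} {ψ : D →* ℂˣ} :
    IsEig D ψ (ind C χ) ↔ ∃ h : D ≤ C, ψ = χ.comp (Subgroup.inclusion h) := by
  have key : ∀ h : D ≤ C, IsEig D (χ.comp (Subgroup.inclusion h)) (ind C χ) := fun h g =>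
    isEig_ind C χ (Subgroup.inclusion h g)
  constructor
  · intro hψ
    have h : D ≤ C := fun g hg => mem_of_eigen_ind (hψ ⟨g, hg⟩)
    exact ⟨h, hψ.unique (key h)⟩
  · rintro ⟨h, rfl⟩
    exact key h

end GliderClass

variable [Finite G]

/-- The map `f ↦ ∑ f(x) ρ(x⁻¹) v` sends the translate of the generator by `k` to `|C|` equal copies
of `ρ k v`; divide by `|C|`. -/
theorem link_extChar {V : Type} [AddCommGroup V] [Module ℂ V] {ρ : Representation ℂ G V} {v : V}
    {C : Subgroup G} {χ : C →* ℂˣ} (h : ∀ g : C, ρ g v = (χ g : ℂ) • v) :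
    Link (funRep G) (extChar C χ) ρ v := by
  classical
  have := Fintype.ofFinite G
  let φ : (G → ℂ) →ₗ[ℂ] V := ∑ x : G, (LinearMap.proj x).smulRight (ρ x⁻¹ v)
  have hφ : ∀ k, φ (funRep G k (extChar C χ)) = (Fintype.card C : ℂ) • ρ k v := by
    intro k
    simp only [φ, LinearMap.sum_apply, LinearMap.smulRight_apply, LinearMap.proj_apply,
      funRep_apply]
    rw [← Fintype.sum_equiv (Equiv.mulRight k⁻¹) _ _ fun _ => rfl]
    have : ∀ y : G, extChar C χ (y * k⁻¹ * k) • ρ (y * k⁻¹)⁻¹ v =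
        if y ∈ C then ρ k v else 0 := by
      intro y
      split_ifs with hy
      · lift y to C using hy
        have h1 : ρ ((y : G)⁻¹) v = ((χ y)⁻¹ : ℂ) • v := by
          have := h y⁻¹
          simpa using this
        simp [extChar_coe, h1]
      · simp [extChar_of_notMem χ hy]
    simp only [Equiv.coe_mulRight, this]
    rw [← Finset.sum_filter, Finset.sum_const, ← Nat.cast_smul_eq_nsmul ℂ]
    congr 2
    exact (Fintype.card_subtype _).symm
  have hc : (Fintype.card C : ℂ) ≠ 0 := by simp
  exact ⟨(Fintype.card C : ℂ)⁻¹ • φ, fun g => by simp [hφ, smul_smul, hc]⟩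

omit [Finite G] in
-- Frobenius reciprocity: a functional `F` gives the matrix coefficient map `w ↦ (x ↦ F (ρ x w))`.
-- With `link_extChar`, recognising an induced class reduces to finding one functional.
theorem link_to_extChar {V : Type} [AddCommGroup V] [Module ℂ V] {ρ : Representation ℂ G V}
    {v : V} {C : Subgroup G} {χ : C →* ℂˣ} (F : V →ₗ[ℂ] ℂ) (h : ∀ g, F (ρ g v) = extChar C χ g) :
    Link ρ v (funRep G) (extChar C χ) := by
  refine ⟨LinearMap.pi fun x => F ∘ₗ ρ x, fun g => funext fun x => ?_⟩
  simp [funRep_apply, ← h]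

/-! ### Absorption by induced classes, and nilpotent differences -/

namespace GliderClass

/-- Evaluation at `1` on the induced factor kills translates by elements outside `C`. Multiplication
by `ind C 1` therefore forgets everything about `s` except its character on `C`. -/
theorem mul_ind_one {s : GliderClass G} {C : Subgroup G} {χ : C →* ℂˣ} (h : IsEig C χ s) :
    s * ind C 1 = ind C χ := by
  have h2 : IsEig C χ (s * ind C 1) := by
    have h3 := h.mul (isEig_ind C 1)
    rwa [show χ * 1 = χ from mul_one χ] at h3
  obtain ⟨_, _, _, ρ, v, hv, rfl⟩ := s.exists_ofVec
  rw [ind, ofVec_mul] at *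
  obtain ⟨f, hf⟩ := Module.Projective.exists_dual_ne_zero ℂ hv
  rw [isEig_ofVec] at h h2
  refine ofVec_eq (link_to_extChar ((f v)⁻¹ • TensorProduct.lift
    (f.smulRight (LinearMap.proj 1))) fun g => ?_) (link_extChar h2)
  by_cases hg : g ∈ C
  · lift g to C using hg
    simp [h, funRep_apply, extChar_coe]
    field_simp
  · simp [funRep_apply, extChar_of_notMem _ hg]

omit [Finite G] in
/-- If no element of `T` has the generator as eigenvector, then some functional is `1` on the
generator of a power of the glider and vanishes on its translates by `T`. -/
theorem exists_pow_functional (s : GliderClass G) (T : Finset G)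
    (hT : ∀ g ∈ T, ∀ c, (g, c) ∉ s.eigen) :
    ∃ (Ω : Type) (_ : AddCommGroup Ω) (_ : Module ℂ Ω) (ρ : Representation ℂ G Ω) (v : Ω)
      (hv : v ≠ 0), s ^ T.card = ofVec ρ v hv ∧ ∃ F : Ω →ₗ[ℂ] ℂ, F v = 1 ∧
        ∀ g ∈ T, F (ρ g v) = 0 := by
  classical
  induction T using Finset.induction_on with
  | empty => exact ⟨ℂ, _, _, _, 1, one_ne_zero, by rw [Finset.card_empty, pow_zero]; rfl,
      LinearMap.id, rfl, by simp⟩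
  | insert a T ha ih =>
    obtain ⟨_, _, _, ρ, v, hv, hs, F, hF, hF'⟩ := ih fun g hg => hT g (by simp [hg])
    have h1 := hT a (by simp)
    rw [Finset.card_insert_of_notMem ha, pow_succ, hs]
    obtain ⟨_, _, _, τ, w, hw, rfl⟩ := s.exists_ofVec
    simp only [mem_eigen_ofVec] at h1
    -- One more tensor factor deals with `a`: a functional `f` that separates `w` from the line of
    -- `τ a w` is multiplied onto `F`, and the zeros of `F` already obtained survive.
    have h2 : w ∉ Submodule.span ℂ {τ a w} := by
      rw [Submodule.mem_span_singleton]
      rintro ⟨c, hc⟩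
      have hc0 : c ≠ 0 := by rintro rfl; exact hw (by simpa using hc.symm)
      exact h1 c⁻¹ (by rw [eq_inv_smul_iff₀ hc0, hc])
    obtain ⟨f, hf, hf'⟩ := Submodule.exists_le_ker_of_notMem h2
    have hf'' : f (τ a w) = 0 := hf' (Submodule.mem_span_singleton_self _)
    refine ⟨_, _, _, _, _, _, ofVec_mul _ _ _ _ _ _,
      (f w)⁻¹ • TensorProduct.lift (F.smulRight f), by simp [hF, hf], fun g hg => ?_⟩
    rcases Finset.mem_insert.1 hg with rfl | hg
    · simp [hf'']
    · simp [hF' g hg]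

/-- The elements with the generator as eigenvector. -/
def stab (s : GliderClass G) : Subgroup G where
  carrier := {g | ∃ c, (g, c) ∈ s.eigen}
  mul_mem' := by
    obtain ⟨_, _, _, ρ, v, hv, rfl⟩ := s.exists_ofVec
    simp only [mem_eigen_ofVec]
    rintro a b ⟨c, hc⟩ ⟨d, hd⟩
    exact ⟨d * c, by simp [hc, hd, mul_smul]⟩
  one_mem' := by
    obtain ⟨_, _, _, ρ, v, hv, rfl⟩ := s.exists_ofVec
    simp only [mem_eigen_ofVec]
    exact ⟨1, by simp⟩
  inv_mem' := by
    obtain ⟨_, _, _, ρ, v, hv, rfl⟩ := s.exists_ofVec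
    simp only [mem_eigen_ofVec]
    rintro a ⟨c, hc⟩
    have h1 := congrArg (ρ a⁻¹) hc
    have hc0 : c ≠ 0 := by rintro rfl; exact hv (by simpa using h1)
    exact ⟨c⁻¹, by rw [eq_inv_smul_iff₀ hc0, ← map_smul, ← hc]; simp⟩

omit [Finite G] in
theorem mem_stab {s : GliderClass G} {g : G} : g ∈ s.stab ↔ ∃ c, (g, c) ∈ s.eigen := Iff.rfl

omit [Finite G] in
theorem exists_isEig_stab (s : GliderClass G) : ∃ χ, IsEig s.stab χ s :=
  exists_isEig fun _ hg => hg

omit [Finite G] in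
theorem IsEig.pow {C : Subgroup G} {χ : C →* ℂˣ} {s : GliderClass G} (h : IsEig C χ s) (n : ℕ) :
    IsEig C (χ ^ n) (s ^ n) := by
  induction n with
  | zero =>
    rw [pow_zero, show χ ^ 0 = 1 from pow_zero χ]
    exact isEig_one C
  | succ n ih =>
    rw [pow_succ, show χ ^ (n + 1) = χ ^ n * χ from pow_succ χ n]
    exact ih.mul h

/-- One factor for each element outside the stabiliser yields a functional vanishing on all those
translates. On the stabiliser the power acts by a character, so both links with the induced class
exist. -/
theorem exists_pow_eq_ind (s : GliderClass G) :
    ∃ (n : ℕ) (χ : s.stab →* ℂˣ), s ^ n = ind s.stab χ := by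
  classical
  have := Fintype.ofFinite G
  obtain ⟨χ, hχ⟩ := s.exists_isEig_stab
  have h1 := hχ.pow (Finset.univ.filter (· ∉ s.stab)).card
  obtain ⟨Ω, _, _, ρ, v, hv, hs, F, hF, hF'⟩ :=
    s.exists_pow_functional (Finset.univ.filter (· ∉ s.stab))
      (fun g hg c hc => (Finset.mem_filter.1 hg).2 ⟨c, hc⟩)
  refine ⟨_, _, hs.trans (ofVec_eq (link_to_extChar (χ := χ ^
    (Finset.univ.filter (· ∉ s.stab)).card) F fun g => ?_) (link_extChar ?_))⟩
  · by_cases hg : g ∈ s.stab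
    · lift g to s.stab using hg
      rw [hs, isEig_ofVec] at h1
      rw [h1, map_smul, hF, extChar_coe, smul_eq_mul, mul_one]
    · rw [hF' g (by simp [hg]), extChar_of_notMem _ hg]
  · rwa [hs, isEig_ofVec] at h1

omit [Finite G] in
theorem stab_congr {s t : GliderClass G} (h : s.eigen = t.eigen) : s.stab = t.stab := by
  ext g; simp [mem_stab, h]

/-- The nilradical is the intersection of the primes, so it suffices to compare `s` and `t` modulo
each prime `P`, where the class `ind s.stab 1` is either zero or cancellable. -/
theorem isNilpotent_sub {s t : GliderClass G} (h : s.eigen = t.eigen) :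
    IsNilpotent (MonoidAlgebra.of ℚ _ s - MonoidAlgebra.of ℚ _ t) := by
  rw [← mem_nilradical, nilradical_eq_sInf, Ideal.mem_sInf]
  intro P hP
  have hP : P.IsPrime := hP
  obtain ⟨χ, hχ⟩ := s.exists_isEig_stab
  have hχ' : IsEig s.stab χ t := fun g => h ▸ hχ g
  have h1 := (mul_ind_one hχ).trans (mul_ind_one hχ').symm
  let f : GliderClass G →* (MonoidAlgebra ℚ (GliderClass G) ⧸ P) :=
    (Ideal.Quotient.mk P : _ →* _).comp (MonoidAlgebra.of ℚ _)
  -- Some power of `u` is induced from this stabiliser, hence a multiple of `ind s.stab 1`; the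
  -- quotient by `P` is a domain.
  have key : ∀ u : GliderClass G, u.stab = s.stab → f (ind s.stab 1) = 0 → f u = 0 := by
    intro u hu h0
    obtain ⟨n, ψ, hn⟩ := u.exists_pow_eq_ind
    have h3 : f (ind u.stab ψ) = 0 := by
      have h4 : f (ind u.stab 1) = 0 := by rw [hu]; exact h0
      rw [← mul_ind_one (isEig_ind u.stab ψ), map_mul, h4, mul_zero]
    rw [← hn, map_pow] at h3
    exact eq_zero_of_pow_eq_zero h3
  have h2 : f s * f (ind s.stab 1) = f t * f (ind s.stab 1) := by rw [← map_mul, ← map_mul, h1]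
  rw [← Ideal.Quotient.eq]
  change f s = f t
  by_cases h0 : f (ind s.stab 1) = 0
  · rw [key s rfl h0, key t (stab_congr h).symm h0]
  · exact mul_right_cancel₀ h0 h2

end GliderClass

end GliderQ8

namespace GliderQ8

/-! ### The Jacobson radical for a finite group -/

variable {G : Type} [Group G]

open GliderClass

/-- `eigVal` as a homomorphism of algebras. -/
def eigAlg (C : Subgroup G) : CharAlg G →ₐ[ℚ] MonoidAlgebra ℚ (CharGroup C) :=
  MonoidAlgebra.lift ℚ _ _ (eigValHom C)

theorem eigAlg_of (C : Subgroup G) (s : GliderClass G) :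
    eigAlg C (MonoidAlgebra.of ℚ _ s) = eigVal C s :=
  MonoidAlgebra.lift_of _ _

variable (G) in
/-- The homomorphisms `eigAlg` for all subgroups. -/
def eigAlgPi : CharAlg G →ₐ[ℚ] ((C : Subgroup G) → MonoidAlgebra ℚ (CharGroup C)) :=
  AlgHom.pi eigAlg

theorem eigAlgPi_of (s : GliderClass G) :
    eigAlgPi G (MonoidAlgebra.of ℚ _ s) = fun C => eigVal C s :=
  funext fun C => eigAlg_of C s

variable (G) in
/-- The span of the differences of classes with the same eigenvalues. -/
def eigenSpan : Submodule ℚ (CharAlg G) :=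
  Submodule.span ℚ {z | ∃ s t : GliderClass G, s.eigen = t.eigen ∧
    z = MonoidAlgebra.of ℚ _ s - MonoidAlgebra.of ℚ _ t}

theorem eigAlgPi_eq_zero_of_mem {x : CharAlg G} (hx : x ∈ eigenSpan G) : eigAlgPi G x = 0 := by
  have : eigenSpan G ≤ LinearMap.ker (eigAlgPi G).toLinearMap := by
    refine Submodule.span_le.2 ?_
    rintro _ ⟨s, t, h, rfl⟩
    simp only [SetLike.mem_coe, LinearMap.mem_ker, AlgHom.toLinearMap_apply, map_sub,
      eigAlgPi_of, sub_eq_zero]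
    exact funext fun C => eigVal_congr h C
  exact this hx

theorem eigen_eq_of_isEig {C : Subgroup G} {χ : C →* ℂˣ} {s : GliderClass G}
    (h : IsEig C χ s) (h' : ∀ g c, (g, c) ∈ s.eigen → g ∈ C) :
    s.eigen = Set.range fun g : C => ((g : G), (χ g : ℂ)) := by
  ext ⟨g, c⟩
  constructor
  · intro hg
    have hC := h' g c hg
    exact ⟨⟨g, hC⟩, Prod.ext rfl (eigen_unique (h ⟨g, hC⟩) hg)⟩
  · rintro ⟨x, hx⟩
    rw [← hx]
    exact h x

/-- Modulo `eigenSpan` every class becomes an induced one, so only finitely many classes remain. -/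
theorem eigen_eq_ind {s : GliderClass G} {χ : s.stab →* ℂˣ} (h : IsEig s.stab χ s) :
    s.eigen = (ind s.stab χ).eigen := by
  rw [eigen_eq_of_isEig h fun g c hg => ⟨c, hg⟩,
    eigen_eq_of_isEig (isEig_ind s.stab χ) fun g c hg => mem_of_eigen_ind hg]

variable [Finite G]

/-- Triangularity: the image of `ind C χ` is supported on subgroups of `C`, with component `χ` at
`C` itself. Induction on inclusion removes the smaller components. -/
theorem single_of_mem_range [DecidableEq (Subgroup G)] (C : Subgroup G) (χ : C →* ℂˣ) :
    Pi.single C (MonoidAlgebra.of ℚ (CharGroup C) χ) ∈ LinearMap.range (eigAlgPi G).toLinearMap := by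
  have := Fintype.ofFinite (Subgroup G)
  induction C using WellFoundedLT.induction with
  | ind C ih =>
    have h1 : eigAlgPi G (MonoidAlgebra.of ℚ _ (ind C χ)) =
        Pi.single C (MonoidAlgebra.of ℚ (CharGroup C) χ) +
        ∑ D ∈ Finset.univ.erase C, Pi.single D (eigVal D (ind C χ)) := by
      rw [eigAlgPi_of, ← eigVal_of_isEig (isEig_ind C χ),
        Finset.add_sum_erase _ (fun D => Pi.single D (eigVal D (ind C χ))) (Finset.mem_univ C)]
      exact (Finset.univ_sum_single _).symm
    rw [eq_sub_of_add_eq h1.symm]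
    refine Submodule.sub_mem _ ⟨_, rfl⟩ (Submodule.sum_mem _ fun D hD => ?_)
    by_cases h : ∃ ψ, IsEig D ψ (ind C χ)
    · obtain ⟨ψ, hψ⟩ := h
      rw [eigVal_of_isEig hψ]
      obtain ⟨hle, -⟩ := isEig_ind_iff.1 hψ
      exact ih D (lt_of_le_of_ne hle (Finset.ne_of_mem_erase hD)) ψ
    · rw [eigVal_of_not h, Pi.single_zero]
      exact Submodule.zero_mem _

theorem eigAlgPi_surjective : Function.Surjective (eigAlgPi G) := by
  classical
  have := Fintype.ofFinite (Subgroup G)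
  intro x
  change x ∈ LinearMap.range (eigAlgPi G).toLinearMap
  rw [← Finset.univ_sum_single x]
  refine Submodule.sum_mem _ fun C _ => ?_
  induction x C using MonoidAlgebra.induction_linear with
  | zero => rw [Pi.single_zero]; exact Submodule.zero_mem _
  | add a b ha hb => rw [Pi.single_add]; exact Submodule.add_mem _ ha hb
  | single χ r =>
    have := Submodule.smul_mem _ r (single_of_mem_range C χ)
    rwa [← Pi.single_smul, MonoidAlgebra.of_apply, MonoidAlgebra.smul_single, smul_eq_mul,
      mul_one] at this

theorem finrank_monoidAlgebra (M : Type) [Fintype M] :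
    Module.finrank ℚ (MonoidAlgebra ℚ M) = Fintype.card M := by
  rw [(MonoidAlgebra.coeffLinearEquiv ℚ : MonoidAlgebra ℚ M ≃ₗ[ℚ] _).finrank_eq,
    Module.finrank_finsupp_self]

/-- Induced classes span modulo `eigenSpan`, and there are as many pairs `(C, χ)` as the dimension
of the target. Surjectivity thus makes `eigAlgPi` injective on their formal combinations. -/
theorem mem_eigenSpan_iff {x : CharAlg G} : x ∈ eigenSpan G ↔ eigAlgPi G x = 0 := by
  classical
  refine ⟨eigAlgPi_eq_zero_of_mem, fun hx => ?_⟩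
  have := Fintype.ofFinite (Subgroup G)
  have := fun C : Subgroup G => Fintype.ofFinite (CharGroup C)
  let T : ((Σ C : Subgroup G, CharGroup C) →₀ ℚ) →ₗ[ℚ] CharAlg G :=
    Finsupp.linearCombination ℚ fun d => MonoidAlgebra.of ℚ _ (ind d.1 d.2)
  have hT : ∀ y : CharAlg G, ∃ c, y - T c ∈ eigenSpan G := by
    intro y
    induction y using MonoidAlgebra.induction_linear with
    | zero => exact ⟨0, by simp⟩
    | add a b ha hb =>
      obtain ⟨c, hc⟩ := ha
      obtain ⟨d, hd⟩ := hb
      exact ⟨c + d, by rw [map_add, add_sub_add_comm]; exact Submodule.add_mem _ hc hd⟩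
    | single s r =>
      obtain ⟨χ, hχ⟩ := s.exists_isEig_stab
      refine ⟨Finsupp.single ⟨s.stab, χ⟩ r, ?_⟩
      have h1 : MonoidAlgebra.single s r = r • MonoidAlgebra.of ℚ _ s := by simp
      rw [Finsupp.linearCombination_single, h1, ← smul_sub]
      exact Submodule.smul_mem _ _ (Submodule.subset_span ⟨_, _, eigen_eq_ind hχ, rfl⟩)
  have hsurj : Function.Surjective ((eigAlgPi G).toLinearMap ∘ₗ T) := by
    intro z
    obtain ⟨y, rfl⟩ := eigAlgPi_surjective z
    obtain ⟨c, hc⟩ := hT y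
    have := eigAlgPi_eq_zero_of_mem hc
    rw [map_sub, sub_eq_zero] at this
    exact ⟨c, this.symm⟩
  have hfin : Module.finrank ℚ ((Σ C : Subgroup G, CharGroup C) →₀ ℚ) =
      Module.finrank ℚ ((C : Subgroup G) → MonoidAlgebra ℚ (CharGroup C)) := by
    rw [Module.finrank_pi_fintype, Module.finrank_finsupp_self, Fintype.card_sigma]
    simp only [finrank_monoidAlgebra]
  have hinj := (LinearMap.injective_iff_surjective_of_finrank_eq_finrank hfin).2 hsurj
  obtain ⟨c, hc⟩ := hT x
  have h0 := eigAlgPi_eq_zero_of_mem hc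
  rw [map_sub, hx, zero_sub, neg_eq_zero] at h0
  have hc0 : c = 0 := hinj (by rw [map_zero]; exact h0)
  rwa [hc0, map_zero, sub_zero] at hc

theorem isNilpotent_of_mem_eigenSpan {x : CharAlg G} (hx : x ∈ eigenSpan G) :
    IsNilpotent x := by
  have : eigenSpan G ≤ (nilradical (CharAlg G)).restrictScalars ℚ := by
    refine Submodule.span_le.2 ?_
    rintro _ ⟨s, t, h, rfl⟩
    exact isNilpotent_sub h
  exact this hx

theorem mem_jacobson_of_isNilpotent {R : Type*} [CommRing R] {x : R} (hx : IsNilpotent x) :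
    x ∈ Ring.jacobson R := nilradical_le_jacobson R hx

theorem map_eq_zero_of_mem_jacobson {R S : Type*} [Ring R] [Ring S] [IsSemisimpleRing S]
    (f : R →+* S) (hf : Function.Surjective f) {x : R} (hx : x ∈ Ring.jacobson R) : f x = 0 := by
  have : RingHomSurjective f := ⟨hf⟩
  have h1 := Ring.le_comap_jacobson f hx
  rwa [Ideal.mem_comap, IsSemisimpleRing.jacobson_eq_bot] at h1

theorem mem_jacobson_iff {x : CharAlg G} : x ∈ Ring.jacobson (CharAlg G) ↔ x ∈ eigenSpan G := by
  refine ⟨fun hx => ?_, fun hx => mem_jacobson_of_isNilpotent (isNilpotent_of_mem_eigenSpan hx)⟩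
  rw [mem_eigenSpan_iff]
  funext C
  have hs : Function.Surjective (eigAlg C) := fun y => by
    classical
    obtain ⟨z, hz⟩ := eigAlgPi_surjective (Pi.single C y)
    exact ⟨z, (congrFun hz C).trans (Pi.single_eq_same (M := fun C : Subgroup G =>
      MonoidAlgebra ℚ (CharGroup C)) C y)⟩
  -- The group order is invertible in `ℚ`, so Maschke's theorem makes the group algebra semisimple.
  have : NeZero (Nat.card (CharGroup C) : ℚ) := ⟨Nat.cast_ne_zero.2 Nat.card_pos.ne'⟩
  exact map_eq_zero_of_mem_jacobson (S := MonoidAlgebra ℚ (CharGroup C))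
    (eigAlg C : CharAlg G →+* MonoidAlgebra ℚ (CharGroup C)) hs hx

theorem jacobson_eq_ker : Ring.jacobson (CharAlg G) = RingHom.ker (eigAlgPi G) :=
  Ideal.ext fun _ => mem_jacobson_iff.trans mem_eigenSpan_iff

end GliderQ8

namespace GliderQ8

/-! ### Inflation -/

section Inflation

variable {G H : Type} [Group G] [Group H]

open GliderClass

theorem Link.comp {V W : Type} [AddCommGroup V] [Module ℂ V] [AddCommGroup W] [Module ℂ W]
    {ρ : Representation ℂ H V} {v : V} {τ : Representation ℂ H W} {w : W} (f : G →* H)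
    (h : Link ρ v τ w) : Link (ρ.comp f) v (τ.comp f) w := by
  obtain ⟨φ, hφ⟩ := h
  exact ⟨φ, fun g => hφ (f g)⟩

/-- Links pull back along `f`, so the inflated class does not depend on the representative; this is
the well-definedness behind `inflation`. -/
theorem GliderClass.exists_inflation (f : G →* H) (s : GliderClass H) :
    ∃ t : GliderClass G, ∀ (Ω : Type) (_ : AddCommGroup Ω) (_ : Module ℂ Ω)
      (ρ : Representation ℂ H Ω) (v : Ω) (hv : v ≠ 0), s = ofVec ρ v hv →
      t = ofVec (ρ.comp f : Representation ℂ G Ω) v hv := by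
  obtain ⟨Ω, _, _, ρ, v, hv, rfl⟩ := s.exists_ofVec
  refine ⟨ofVec (ρ.comp f : Representation ℂ G Ω) v hv, ?_⟩
  intro _ _ _ τ w hw h
  obtain ⟨h1, h2⟩ := links_of_ofVec_eq h
  exact ofVec_eq (h1.comp f) (h2.comp f)

/-- The inflation of a class along a homomorphism. -/
def GliderClass.inflation (f : G →* H) (s : GliderClass H) : GliderClass G :=
  (s.exists_inflation f).choose

theorem GliderClass.inflation_ofVec (f : G →* H) {Ω : Type} [AddCommGroup Ω] [Module ℂ Ω]
    (ρ : Representation ℂ H Ω) (v : Ω) (hv : v ≠ 0) :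
    inflation f (ofVec ρ v hv) = ofVec (ρ.comp f : Representation ℂ G Ω) v hv :=
  ((ofVec ρ v hv).exists_inflation f).choose_spec _ _ _ ρ v hv rfl

/-- Inflation as a homomorphism of monoids. -/
def GliderClass.inflationHom (f : G →* H) : GliderClass H →* GliderClass G where
  toFun := inflation f
  map_one' := inflation_ofVec f (Representation.trivial ℂ H ℂ) 1 one_ne_zero
  map_mul' s t := by
    obtain ⟨_, _, _, ρ, v, hv, rfl⟩ := s.exists_ofVec
    obtain ⟨_, _, _, τ, w, hw, rfl⟩ := t.exists_ofVec
    rw [ofVec_mul, inflation_ofVec, inflation_ofVec, inflation_ofVec, ofVec_mul]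
    rfl

theorem GliderClass.inflationHom_injective {f : G →* H} (hf : Function.Surjective f) :
    Function.Injective (inflationHom f) := by
  intro s t h
  obtain ⟨_, _, _, ρ, v, hv, rfl⟩ := s.exists_ofVec
  obtain ⟨_, _, _, τ, w, hw, rfl⟩ := t.exists_ofVec
  change inflation f _ = inflation f _ at h
  rw [inflation_ofVec, inflation_ofVec] at h
  obtain ⟨⟨φ, hφ⟩, ψ, hψ⟩ := links_of_ofVec_eq h
  exact ofVec_eq ⟨φ, hf.forall.2 hφ⟩ ⟨ψ, hf.forall.2 hψ⟩

/-- Inflation as a homomorphism of algebras. -/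
def inflationAlg (f : G →* H) : CharAlg H →ₐ[ℚ] CharAlg G :=
  MonoidAlgebra.mapDomainAlgHom ℚ ℚ (inflationHom f)

theorem inflationAlg_of (f : G →* H) (s : GliderClass H) :
    inflationAlg f (MonoidAlgebra.of ℚ _ s) = MonoidAlgebra.of ℚ _ (s.inflation f) :=
  MonoidAlgebra.mapDomain_single

theorem inflationAlg_injective {f : G →* H} (hf : Function.Surjective f) :
    Function.Injective (inflationAlg f) :=
  MonoidAlgebra.mapDomain_injective (inflationHom_injective hf)

theorem chi_of_ne {V : Type} [AddCommGroup V] [Module ℂ V] (ρ : Representation ℂ G V) {v : V}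
    (hv : v ≠ 0) : chi ρ v = MonoidAlgebra.of ℚ _ (ofVec ρ v hv) := dif_pos hv

theorem chi_zero {V : Type} [AddCommGroup V] [Module ℂ V] (ρ : Representation ℂ G V) :
    chi ρ 0 = 0 := dif_neg (by simp)

end Inflation

/-! ### The quaternion group -/

open GliderClass

theorem toV4_surjective : Function.Surjective toV4 := by decide

theorem indVec_ne_zero {A : Finset V4} (hA : A.Nonempty) : indVec A ≠ 0 := by
  obtain ⟨x, hx⟩ := hA
  intro h
  simpa [indVec, hx] using congrFun h x

theorem indVec_empty : indVec ∅ = 0 := by ext; simp [indVec]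

theorem inflation_indVec {A : Finset V4} (hA : indVec A ≠ 0)
    (hA' : ((indVec A, 0, 0) : (V4 → ℂ) × (Fin 2 → ℂ) × (Fin 2 → ℂ)) ≠ 0) :
    inflation toV4 (ofVec repV4 (indVec A) hA) = ofVec repQ8 (indVec A, 0, 0) hA' := by
  rw [inflation_ofVec]
  refine ofVec_eq ⟨LinearMap.inl ℂ _ _, fun g => ?_⟩ ⟨LinearMap.fst ℂ _ _, fun g => ?_⟩
  · simp [repQ8]
    rfl
  · simp [repQ8]

theorem inflationAlg_chiV4 (A : Finset V4) : inflationAlg toV4 (chiV4 A) = chiEmpty A := by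
  -- For `A = ∅` the vector is zero and both sides are the default value `0` of `chi`.
  rcases A.eq_empty_or_nonempty with rfl | hA
  · rw [chiV4, chiEmpty, indVec_empty]
    exact (congrArg _ (chi_zero _)).trans ((map_zero _).trans (chi_zero _).symm)
  · have h := indVec_ne_zero hA
    have h' : ((indVec A, 0, 0) : (V4 → ℂ) × (Fin 2 → ℂ) × (Fin 2 → ℂ)) ≠ 0 := fun h0 =>
      h (congrArg Prod.fst h0)
    rw [chiV4, chiEmpty, chi_of_ne _ h, chi_of_ne _ h', inflationAlg_of, inflation_indVec]

open QuaternionGroup in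
theorem Q8.cases (g : Q8) : g = a 0 ∨ g = a 1 ∨ g = a 2 ∨ g = a 3 ∨ g = xa 0 ∨ g = xa 1 ∨
    g = xa 2 ∨ g = xa 3 := by
  revert g; decide

open QuaternionGroup in
theorem Q8.sum_eq {M : Type*} [AddCommMonoid M] (f : Q8 → M) :
    ∑ g, f g = f (a 0) + f (a 1) + f (a 2) + f (a 3) + f (xa 0) + f (xa 1) + f (xa 2) +
      f (xa 3) := by
  have h : (Finset.univ : Finset Q8) = {a 0, a 1, a 2, a 3, xa 0, xa 1, xa 2, xa 3} := by decide
  rw [h]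
  repeat rw [Finset.sum_insert (by decide)]
  rw [Finset.sum_singleton]
  simp only [add_assoc]

/-! ### Matrix coefficients and characters of the quaternion group -/

section Table

open QuaternionGroup

theorem matU_a0 : matU (a 0) = !![1, 0; 0, 1] := by
  rw [← Matrix.one_fin_two]; rfl

theorem matU_a1 : matU (a 1) = !![0, Complex.I; Complex.I, 0] := pow_one matI

theorem matU_a2 : matU (a 2) = !![-1, 0; 0, -1] := by
  refine matI_sq.trans ?_
  rw [Matrix.one_fin_two]
  simp

theorem matU_a3 : matU (a 3) = !![0, -Complex.I; -Complex.I, 0] := by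
  refine (pow_succ matI 2).trans ?_
  rw [matI_sq]
  simp [matI]

theorem matU_xa0 : matU (xa 0) = !![-Complex.I, 0; 0, Complex.I] := mul_one matJ

theorem matU_xa1 : matU (xa 1) = !![0, 1; -1, 0] := by
  rw [show (xa 1 : Q8) = xa 0 * a 1 by decide, map_mul, matU_xa0, matU_a1]
  simp

theorem matU_xa2 : matU (xa 2) = !![Complex.I, 0; 0, -Complex.I] := by
  rw [show (xa 2 : Q8) = xa 0 * a 2 by decide, map_mul, matU_xa0, matU_a2]
  simp

theorem matU_xa3 : matU (xa 3) = !![0, -1; 1, 0] := by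
  rw [show (xa 3 : Q8) = xa 0 * a 3 by decide, map_mul, matU_xa0, matU_a3]
  simp

theorem repU_apply (g : Q8) (p : Fin 2 → ℂ) : repU g p = (matU g).mulVec p := rfl

theorem inv_a0 : (a 0 : Q8)⁻¹ = a 0 := by decide
theorem inv_a1 : (a 1 : Q8)⁻¹ = a 3 := by decide
theorem inv_a2 : (a 2 : Q8)⁻¹ = a 2 := by decide
theorem inv_a3 : (a 3 : Q8)⁻¹ = a 1 := by decide
theorem inv_xa0 : (xa 0 : Q8)⁻¹ = xa 2 := by decide
theorem inv_xa1 : (xa 1 : Q8)⁻¹ = xa 3 := by decide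
theorem inv_xa2 : (xa 2 : Q8)⁻¹ = xa 0 := by decide
theorem inv_xa3 : (xa 3 : Q8)⁻¹ = xa 1 := by decide

/-- Schur orthogonality for `U`, with `4 = |Q₈| / dim U`. -/
theorem matU_orthogonal (i j : Fin 2) :
    ∑ g : Q8, matU g⁻¹ 0 i * matU g j 0 = if i = j then 4 else 0 := by
  rw [Q8.sum_eq]
  simp only [inv_a0, inv_a1, inv_a2, inv_a3, inv_xa0, inv_xa1, inv_xa2, inv_xa3, matU_a0, matU_a1,
    matU_a2, matU_a3, matU_xa0, matU_xa1, matU_xa2, matU_xa3]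
  fin_cases i <;> fin_cases j <;> simp <;> norm_num

/-- The value at `g` of the character of `T_x`. -/
def sgn (x : V4) (g : Q8) : ℂ := (((linChar x (toV4 g) : ℤˣ) : ℤ) : ℂ)

theorem sgn_mul (x : V4) (g h : Q8) : sgn x (g * h) = sgn x g * sgn x h := by simp [sgn]

theorem sgn_mul_self (x : V4) (g : Q8) : sgn x g * sgn x g = 1 := by
  rcases Int.units_eq_one_or (linChar x (toV4 g)) with h | h <;> simp [sgn, h]

theorem sgn_a2 (x : V4) : sgn x (a 2) = 1 := by
  have : linChar x (toV4 (a 2)) = 1 := by revert x; decide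
  simp [sgn, this]

theorem sgn_one (x : V4) : sgn x 1 = 1 := by simp [sgn]

/-- The regular character as the sum of irreducible characters weighted by dimension; it makes the
isotypic projections add up to the identity. -/
theorem sum_sgn (g : Q8) : ∑ x, sgn x g + 2 * ∑ i, matU g⁻¹ i i = if g = 1 then 8 else 0 := by
  have h : ∑ x, sgn x g = ((∑ x, ((linChar x (toV4 g) : ℤˣ) : ℤ) : ℤ) : ℂ) := by simp [sgn]
  rw [h]
  have h1 : ∀ g : Q8, ∑ x, ((linChar x (toV4 g) : ℤˣ) : ℤ) = if g = a 0 ∨ g = a 2 then 4 else 0 := by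
    decide
  rw [h1]
  rcases Q8.cases g with rfl | rfl | rfl | rfl | rfl | rfl | rfl | rfl
  · rw [if_pos (by decide), if_pos (by decide), inv_a0, matU_a0]; simp; norm_num
  · rw [if_neg (by decide), if_neg (by decide), inv_a1, matU_a3]; simp
  · rw [if_pos (by decide), if_neg (by decide), inv_a2, matU_a2]; simp; norm_num
  · rw [if_neg (by decide), if_neg (by decide), inv_a3, matU_a1]; simp
  · rw [if_neg (by decide), if_neg (by decide), inv_xa0, matU_xa2]; simp
  · rw [if_neg (by decide), if_neg (by decide), inv_xa1, matU_xa3]; simp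
  · rw [if_neg (by decide), if_neg (by decide), inv_xa2, matU_xa0]; simp
  · rw [if_neg (by decide), if_neg (by decide), inv_xa3, matU_xa1]; simp

end Table

end GliderQ8

namespace GliderQ8

open GliderClass

/-! ### Classification of the classes for the quaternion group -/

section Classification

variable {Ω : Type} [AddCommGroup Ω] [Module ℂ Ω] (ρ : Representation ℂ Q8 Ω)

/-- The projection to the isotypic part of `T_x`. -/
def linOp (x : V4) : Ω →ₗ[ℂ] Ω := (8⁻¹ : ℂ) • ∑ g, sgn x g • ρ g

/-- The operators of the matrix units of `U`. -/
def unitOp (i j : Fin 2) : Ω →ₗ[ℂ] Ω := (4⁻¹ : ℂ) • ∑ g, matU g⁻¹ j i • ρ g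

theorem linOp_apply (x : V4) (w : Ω) : linOp ρ x w = (8⁻¹ : ℂ) • ∑ g, sgn x g • ρ g w := by
  simp [linOp]

theorem unitOp_apply (i j : Fin 2) (w : Ω) :
    unitOp ρ i j w = (4⁻¹ : ℂ) • ∑ g, matU g⁻¹ j i • ρ g w := by
  simp [unitOp]

theorem rho_linOp (x : V4) (h : Q8) (w : Ω) : ρ h (linOp ρ x w) = sgn x h • linOp ρ x w := by
  rw [linOp_apply, map_smul, smul_comm (sgn x h), map_sum]
  refine congrArg (fun t : Ω => (8⁻¹ : ℂ) • t) ?_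
  rw [Finset.smul_sum]
  refine Fintype.sum_equiv (Equiv.mulLeft h) _ _ fun g => ?_
  rw [Equiv.coe_mulLeft, sgn_mul, map_smul, smul_smul, ← mul_assoc, sgn_mul_self, one_mul]
  simp

theorem linOp_rho (x : V4) (h : Q8) (w : Ω) : linOp ρ x (ρ h w) = sgn x h • linOp ρ x w := by
  rw [linOp_apply, linOp_apply, smul_comm (sgn x h)]
  refine congrArg (fun t : Ω => (8⁻¹ : ℂ) • t) ?_
  rw [Finset.smul_sum]
  refine Fintype.sum_equiv (Equiv.mulRight h) _ _ fun g => ?_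
  rw [Equiv.coe_mulRight, sgn_mul, smul_smul, mul_comm (sgn x g), ← mul_assoc, sgn_mul_self,
    one_mul]
  simp

theorem rho_unitOp (i j : Fin 2) (h : Q8) (w : Ω) :
    ρ h (unitOp ρ i j w) = ∑ k, matU h k i • unitOp ρ k j w := by
  simp only [unitOp_apply, map_smul, smul_comm _ (4⁻¹ : ℂ), ← Finset.smul_sum]
  refine congrArg _ ?_
  simp only [Finset.smul_sum, map_sum]
  rw [Finset.sum_comm]
  refine Fintype.sum_equiv (Equiv.mulLeft h) _ _ fun g => ?_
  have h1 : matU g⁻¹ j i = ∑ k, matU (h * g)⁻¹ j k * matU h k i := by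
    rw [← Matrix.mul_apply, ← map_mul]
    simp
  rw [Equiv.coe_mulLeft, map_smul, h1, Finset.sum_smul]
  refine Finset.sum_congr rfl fun k _ => ?_
  rw [smul_smul, mul_comm]
  simp

theorem unitOp_rho (i j : Fin 2) (h : Q8) (w : Ω) :
    unitOp ρ i j (ρ h w) = ∑ k, matU h j k • unitOp ρ i k w := by
  simp only [unitOp_apply, smul_comm _ (4⁻¹ : ℂ), ← Finset.smul_sum]
  refine congrArg _ ?_
  simp only [Finset.smul_sum]
  rw [Finset.sum_comm]
  refine Fintype.sum_equiv (Equiv.mulRight h) _ _ fun g => ?_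
  have h1 : matU g⁻¹ j i = ∑ k, matU h j k * matU (g * h)⁻¹ k i := by
    rw [← Matrix.mul_apply, ← map_mul]
    simp
  rw [Equiv.coe_mulRight, h1, Finset.sum_smul]
  refine Finset.sum_congr rfl fun k _ => ?_
  rw [smul_smul]
  simp

/-- Through this matrix unit relation, the `U`-part of `v` is recovered from the two vectors `unitOp
ρ 0 j v`, which lie in one multiplicity space. -/
theorem unitOp_unitOp (i j : Fin 2) (w : Ω) :
    unitOp ρ i 0 (unitOp ρ 0 j w) = unitOp ρ i j w := by
  rw [unitOp_apply]
  simp only [rho_unitOp, Finset.smul_sum, smul_smul]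
  rw [Finset.sum_comm]
  simp only [← Finset.sum_smul, ← Finset.mul_sum, matU_orthogonal]
  simp

theorem sum_linOp_add_sum_unitOp (w : Ω) :
    ∑ x, linOp ρ x w + ∑ i, unitOp ρ i i w = w := by
  simp only [linOp_apply, unitOp_apply, ← Finset.smul_sum]
  rw [Finset.sum_comm, Finset.sum_comm (γ := Fin 2)]
  simp only [← Finset.sum_smul]
  rw [show (4⁻¹ : ℂ) = 8⁻¹ * 2 by norm_num, mul_smul, ← smul_add, Finset.smul_sum,
    ← Finset.sum_add_distrib]
  simp only [smul_smul, ← add_smul, sum_sgn, ite_smul, zero_smul]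
  simp [smul_smul]

theorem repQ8_apply (g : Q8) (f : V4 → ℂ) (p q : Fin 2 → ℂ) :
    repQ8 g (f, p, q) = (fun x => sgn x g * f x, repU g p, repU g q) := rfl

/-- The equivariant map from the model representation given by the isotypic parts of `v` and two
vectors. -/
def fromModel (v y z : Ω) : ((V4 → ℂ) × (Fin 2 → ℂ) × (Fin 2 → ℂ)) →ₗ[ℂ] Ω :=
  (∑ x, (LinearMap.proj x).smulRight (linOp ρ x v)).coprod
    ((∑ i, (LinearMap.proj i).smulRight (unitOp ρ i 0 y)).coprod
      (∑ i, (LinearMap.proj i).smulRight (unitOp ρ i 0 z)))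

theorem fromModel_apply (v y z : Ω) (f : V4 → ℂ) (p q : Fin 2 → ℂ) :
    fromModel ρ v y z (f, p, q) = ∑ x, f x • linOp ρ x v +
      (∑ i, p i • unitOp ρ i 0 y + ∑ i, q i • unitOp ρ i 0 z) := by
  simp [fromModel]

theorem sum_repU (g : Q8) (p : Fin 2 → ℂ) (y : Ω) :
    ∑ i, repU g p i • unitOp ρ i 0 y = ρ g (∑ i, p i • unitOp ρ i 0 y) := by
  simp only [map_sum, map_smul, rho_unitOp, repU_apply, Matrix.mulVec, dotProduct,
    Finset.sum_smul, Finset.smul_sum, smul_smul]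
  rw [Finset.sum_comm]
  simp only [mul_comm]

theorem fromModel_repQ8 (v y z : Ω) (g : Q8) (m : (V4 → ℂ) × (Fin 2 → ℂ) × (Fin 2 → ℂ)) :
    fromModel ρ v y z (repQ8 g m) = ρ g (fromModel ρ v y z m) := by
  obtain ⟨f, p, q⟩ := m
  rw [repQ8_apply, fromModel_apply, fromModel_apply, map_add, map_add, sum_repU, sum_repU]
  simp only [map_sum, map_smul, rho_linOp, smul_smul, mul_comm]

/-- The equivariant map to the model representation given by functionals. -/
def toModel (F : V4 → Ω →ₗ[ℂ] ℂ) (f f' : Ω →ₗ[ℂ] ℂ) :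
    Ω →ₗ[ℂ] ((V4 → ℂ) × (Fin 2 → ℂ) × (Fin 2 → ℂ)) :=
  (LinearMap.pi fun x => F x ∘ₗ linOp ρ x).prod
    ((LinearMap.pi fun i => f ∘ₗ unitOp ρ 0 i).prod (LinearMap.pi fun i => f' ∘ₗ unitOp ρ 0 i))

theorem toModel_apply (F : V4 → Ω →ₗ[ℂ] ℂ) (f f' : Ω →ₗ[ℂ] ℂ) (w : Ω) :
    toModel ρ F f f' w = (fun x => F x (linOp ρ x w), fun i => f (unitOp ρ 0 i w),
      fun i => f' (unitOp ρ 0 i w)) := rfl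

theorem toModel_rho (F : V4 → Ω →ₗ[ℂ] ℂ) (f f' : Ω →ₗ[ℂ] ℂ) (g : Q8) (w : Ω) :
    toModel ρ F f f' (ρ g w) = repQ8 g (toModel ρ F f f' w) := by
  rw [toModel_apply, toModel_apply, repQ8_apply]
  simp only [linOp_rho, unitOp_rho, map_smul, map_sum, smul_eq_mul]
  rfl

/-- Here `p` and `q` are coordinates of the vectors `unitOp ρ 0 i v` along `y` and `z`, read off by
`f` and `f'`. In each `T_x` only whether the component of `v` vanishes matters, since a nonzero one
can be rescaled to `1`; this gives `A`. -/
theorem exists_model {v : Ω} (hv : v ≠ 0) {p q : Fin 2 → ℂ} {y z : Ω} {f f' : Ω →ₗ[ℂ] ℂ}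
    (hu : ∀ i, unitOp ρ 0 i v = p i • y + q i • z) (hf : ∀ i, f (unitOp ρ 0 i v) = p i)
    (hf' : ∀ i, f' (unitOp ρ 0 i v) = q i) :
    ∃ (A : Finset V4) (h : ((indVec A, p, q) : (V4 → ℂ) × (Fin 2 → ℂ) × (Fin 2 → ℂ)) ≠ 0),
      ofVec ρ v hv = ofVec repQ8 (indVec A, p, q) h := by
  classical
  have hF : ∀ x, ∃ F : Ω →ₗ[ℂ] ℂ, F (linOp ρ x v) = if linOp ρ x v ≠ 0 then 1 else 0 := by
    intro x
    by_cases h : linOp ρ x v = 0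
    · exact ⟨0, by simp [h]⟩
    · obtain ⟨F, hF⟩ := Module.Projective.exists_dual_ne_zero ℂ h
      exact ⟨(F (linOp ρ x v))⁻¹ • F, by simp [h, hF]⟩
  choose F hF using hF
  let A : Finset V4 := Finset.univ.filter fun x => linOp ρ x v ≠ 0
  have h1 : toModel ρ F f f' v = (indVec A, p, q) := by
    rw [toModel_apply]
    refine Prod.ext (funext fun x => ?_) (Prod.ext (funext hf) (funext hf'))
    simp [hF, indVec, A]
  have h2 : fromModel ρ v y z (indVec A, p, q) = v := by
    rw [fromModel_apply]
    conv_rhs => rw [← sum_linOp_add_sum_unitOp ρ v]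
    rw [← Finset.sum_add_distrib]
    refine congrArg₂ _ (Finset.sum_congr rfl fun x _ => ?_) (Finset.sum_congr rfl fun i _ => ?_)
    · by_cases h : linOp ρ x v = 0 <;> simp [indVec, A, h]
    · rw [← map_smul, ← map_smul, ← map_add, ← hu, unitOp_unitOp]
  have h3 : ((indVec A, p, q) : (V4 → ℂ) × (Fin 2 → ℂ) × (Fin 2 → ℂ)) ≠ 0 := by
    intro h
    rw [h, map_zero] at h2
    exact hv h2.symm
  exact ⟨A, h3, ofVec_eq ⟨toModel ρ F f f', fun g => by rw [toModel_rho, h1]⟩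
    ⟨fromModel ρ v y z, fun g => by rw [fromModel_repQ8, h2]⟩⟩

end Classification

theorem exists_dual_of_ne_smul {V : Type} [AddCommGroup V] [Module ℂ V] {v w : V}
    (h : ∀ c : ℂ, v ≠ c • w) : ∃ f : V →ₗ[ℂ] ℂ, f v = 1 ∧ f w = 0 := by
  have h2 : v ∉ Submodule.span ℂ {w} := by
    rw [Submodule.mem_span_singleton]
    rintro ⟨c, hc⟩
    exact h c hc.symm
  obtain ⟨f, hf, hf'⟩ := Submodule.exists_le_ker_of_notMem h2
  have hw : f w = 0 := hf' (Submodule.mem_span_singleton_self _)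
  exact ⟨(f v)⁻¹ • f, by simp [hf], by simp [hw]⟩

/-- Every class is that of one of the vectors of the model representation. -/
theorem exists_eq_model (s : GliderClass Q8) :
    ∃ (A : Finset V4) (p q : Fin 2 → ℂ)
      (h : ((indVec A, p, q) : (V4 → ℂ) × (Fin 2 → ℂ) × (Fin 2 → ℂ)) ≠ 0),
      s = ofVec repQ8 (indVec A, p, q) h ∧
        ((p = 0 ∧ q = 0) ∨ (p ≠ 0 ∧ q = 0) ∨ (p = ![1, 0] ∧ q = ![0, 1])) := by
  obtain ⟨Ω, _, _, ρ, v, hv, rfl⟩ := s.exists_ofVec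
  -- The cases follow the rank of the pair `unitOp ρ 0 0 v`, `unitOp ρ 0 1 v`: rank 0 means that `U`
  -- is absent, rank 1 gives a point of the projective line, rank 2 gives `∗`.
  by_cases h0 : unitOp ρ 0 0 v = 0
  · by_cases h1 : unitOp ρ 0 1 v = 0
    · obtain ⟨A, h, hA⟩ := exists_model ρ hv (p := 0) (q := 0) (y := 0) (z := 0) (f := 0) (f' := 0)
        (Fin.forall_fin_two.2 ⟨by simp [h0], by simp [h1]⟩) (by simp) (by simp)
      exact ⟨A, 0, 0, h, hA, Or.inl ⟨rfl, rfl⟩⟩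
    · obtain ⟨f, hf, -⟩ := exists_dual_of_ne_smul (v := unitOp ρ 0 1 v) (w := 0) (by simpa using h1)
      obtain ⟨A, h, hA⟩ := exists_model ρ hv (p := ![0, 1]) (q := 0) (y := unitOp ρ 0 1 v) (z := 0)
        (f := f) (f' := 0)
        (Fin.forall_fin_two.2 ⟨by simp [h0], by simp⟩)
        (Fin.forall_fin_two.2 ⟨by simp [h0], by simp [hf]⟩) (by simp)
      exact ⟨A, _, 0, h, hA, Or.inr (Or.inl ⟨by simp, rfl⟩)⟩
  · by_cases h1 : ∃ c : ℂ, unitOp ρ 0 1 v = c • unitOp ρ 0 0 v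
    · obtain ⟨c, hc⟩ := h1
      obtain ⟨f, hf, -⟩ := exists_dual_of_ne_smul (v := unitOp ρ 0 0 v) (w := 0) (by simpa using h0)
      obtain ⟨A, h, hA⟩ := exists_model ρ hv (p := ![1, c]) (q := 0) (y := unitOp ρ 0 0 v) (z := 0)
        (f := f) (f' := 0)
        (Fin.forall_fin_two.2 ⟨by simp, by simp [hc]⟩)
        (Fin.forall_fin_two.2 ⟨by simp [hf], by simp [hc, hf]⟩) (by simp)
      exact ⟨A, _, 0, h, hA, Or.inr (Or.inl ⟨by simp, rfl⟩)⟩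
    · push Not at h1
      have h2 : ∀ c : ℂ, unitOp ρ 0 0 v ≠ c • unitOp ρ 0 1 v := by
        intro c hc
        have hc0 : c ≠ 0 := by rintro rfl; exact h0 (by simpa using hc)
        exact h1 c⁻¹ (by rw [hc, smul_smul, inv_mul_cancel₀ hc0, one_smul])
      obtain ⟨f, hf, hf0⟩ := exists_dual_of_ne_smul h2
      obtain ⟨f', hf', hf0'⟩ := exists_dual_of_ne_smul h1
      obtain ⟨A, h, hA⟩ := exists_model ρ hv (p := ![1, 0]) (q := ![0, 1]) (y := unitOp ρ 0 0 v)
        (z := unitOp ρ 0 1 v) (f := f) (f' := f')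
        (Fin.forall_fin_two.2 ⟨by simp, by simp⟩)
        (Fin.forall_fin_two.2 ⟨by simp [hf], by simp [hf0]⟩)
        (Fin.forall_fin_two.2 ⟨by simp [hf0'], by simp [hf']⟩)
      exact ⟨A, _, _, h, hA, Or.inr (Or.inr ⟨rfl, rfl⟩)⟩

end GliderQ8

namespace GliderQ8

open GliderClass QuaternionGroup

/-! ### Eigenvalues of the classes for the quaternion group -/

theorem mem_eigen_model {A : Finset V4} {p q : Fin 2 → ℂ}
    {h : ((indVec A, p, q) : (V4 → ℂ) × (Fin 2 → ℂ) × (Fin 2 → ℂ)) ≠ 0} {g : Q8} {c : ℂ} :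
    (g, c) ∈ (ofVec repQ8 (indVec A, p, q) h).eigen ↔
      (∀ x ∈ A, sgn x g = c) ∧ repU g p = c • p ∧ repU g q = c • q := by
  rw [mem_eigen_ofVec, repQ8_apply, Prod.smul_mk, Prod.smul_mk, Prod.mk.injEq, Prod.mk.injEq]
  refine and_congr_left fun _ => ⟨fun h x hx => ?_, fun h => funext fun x => ?_⟩
  · simpa [indVec, hx] using congrFun h x
  · by_cases hx : x ∈ A <;> simp [indVec, hx, h]

theorem repU_a2 (p : Fin 2 → ℂ) : repU (a 2) p = -p := by
  rw [repU_apply, matU_a2]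
  ext i
  fin_cases i <;> simp [Matrix.mulVec, dotProduct, Fin.sum_univ_two]

theorem smul_eq_iff_of_ne_zero {p : Fin 2 → ℂ} (hp : p ≠ 0) (c : ℂ) : p = c • p ↔ c = 1 :=
  ⟨fun h => (smul_left_injective ℂ hp (by simpa using h)).symm, fun h => by simp [h]⟩

theorem neg_eq_smul_iff_of_ne_zero {p : Fin 2 → ℂ} (hp : p ≠ 0) (c : ℂ) :
    -p = c • p ↔ c = -1 :=
  ⟨fun h => (smul_left_injective ℂ hp (by simpa using h)).symm, fun h => by simp [h]⟩

/-- Every noncentral element squares to `-1`, which acts on `U` as `-1`. -/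
theorem eigenvalue_sq {g : Q8} (hg : g ≠ 1) (hg' : g ≠ a 2) {c : ℂ} {p : Fin 2 → ℂ} (hp : p ≠ 0)
    (h : repU g p = c • p) : c * c = -1 := by
  have h2 : repU (g * g) p = (c * c) • p := by
    rw [map_mul, Module.End.mul_apply, h, map_smul, h, smul_smul]
  have h3 : g * g = a 2 := (by decide : ∀ g : Q8, g ≠ 1 → g ≠ a 2 → g * g = a 2) g hg hg'
  rw [h3, repU_a2] at h2
  exact (neg_eq_smul_iff_of_ne_zero hp _).1 h2

theorem det_repU (g : Q8) (p p' : Fin 2 → ℂ) :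
    repU g p 0 * repU g p' 1 - repU g p 1 * repU g p' 0 = p 0 * p' 1 - p 1 * p' 0 := by
  have hI := Complex.I_mul_I
  rcases Q8.cases g with rfl | rfl | rfl | rfl | rfl | rfl | rfl | rfl <;>
    simp only [repU_apply, Matrix.mulVec, dotProduct, Fin.sum_univ_two, matU_a0, matU_a1, matU_a2,
      matU_a3, matU_xa0, matU_xa1, matU_xa2, matU_xa3] <;> simp <;>
    first
    | ring1
    | linear_combination (p 1 * p' 0 - p 0 * p' 1) * hI

/-- Vectors in one eigenspace of a noncentral element are proportional. -/
theorem det_eq_zero_of_eigen {g : Q8} (hg : g ≠ 1) (hg' : g ≠ a 2) {c : ℂ} {p p' : Fin 2 → ℂ}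
    (h : repU g p = c • p) (h' : repU g p' = c • p') : p 0 * p' 1 - p 1 * p' 0 = 0 := by
  by_cases hp : p = 0
  · simp [hp]
  -- The determinant of the two vectors is preserved by `g` but also multiplied by `c² = -1`, so it
  -- vanishes.
  have h1 := det_repU g p p'
  have h2 := eigenvalue_sq hg hg' hp h
  simp only [h, h', Pi.smul_apply, smul_eq_mul] at h1
  linear_combination (-1 / 2 : ℂ) * h1 + (1 / 2 : ℂ) * (p 0 * p' 1 - p 1 * p' 0) * h2

/-- The excluded points are the eigenlines: `[1:±1]` for `±i`, the coordinate lines for `±j`, and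
`[1:±√-1]` for `±k`. -/
theorem not_isGeneric_of_eigen {g : Q8} (hg : g ≠ 1) (hg' : g ≠ a 2) {c l m : ℂ}
    (h : repU g ![l, m] = c • ![l, m]) : ¬ IsGeneric l m := by
  rintro ⟨hl, hm, h1, h2⟩
  have e0 := congrFun h 0
  have e1 := congrFun h 1
  have hI := Complex.I_ne_zero
  rcases Q8.cases g with rfl | rfl | rfl | rfl | rfl | rfl | rfl | rfl
  · exact hg rfl
  · simp [repU_apply, matU_a1] at e0 e1
    exact h1 (mul_left_cancel₀ hI (by linear_combination m * e0 - l * e1))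
  · exact hg' rfl
  · simp [repU_apply, matU_a3] at e0 e1
    exact h1 (mul_left_cancel₀ hI (by linear_combination -m * e0 + l * e1))
  · simp [repU_apply, matU_xa0] at e0 e1
    have : Complex.I * (2 * (l * m)) = 0 := by linear_combination -m * e0 + l * e1
    simp [hl, hm] at this
  · simp [repU_apply, matU_xa1] at e0 e1
    exact h2 (by linear_combination m * e0 - l * e1)
  · simp [repU_apply, matU_xa2] at e0 e1
    have : Complex.I * (2 * (l * m)) = 0 := by linear_combination m * e0 - l * e1
    simp [hl, hm] at this
  · simp [repU_apply, matU_xa3] at e0 e1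
    exact h2 (by linear_combination -m * e0 + l * e1)

theorem exists_eigen_of_not_isGeneric {l m : ℂ} (h : ¬ IsGeneric l m) :
    ∃ g : Q8, g ≠ 1 ∧ g ≠ a 2 ∧ ∃ c : ℂ, repU g ![l, m] = c • ![l, m] := by
  by_cases hl : l = 0
  · exact ⟨xa 0, by decide, by decide, Complex.I, by
      rw [repU_apply, matU_xa0]; ext i; fin_cases i <;> simp [hl, mul_comm]⟩
  by_cases hm : m = 0
  · exact ⟨xa 0, by decide, by decide, -Complex.I, by
      rw [repU_apply, matU_xa0]; ext i; fin_cases i <;> simp [hm, mul_comm]⟩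
  by_cases h1 : m ^ 2 = l ^ 2
  · refine ⟨a 1, by decide, by decide, Complex.I * m / l, ?_⟩
    rw [repU_apply, matU_a1]
    ext i
    fin_cases i
    · simp; field_simp
    · simp; field_simp; rw [h1]
  by_cases h2 : m ^ 2 = -l ^ 2
  · refine ⟨xa 1, by decide, by decide, m / l, ?_⟩
    rw [repU_apply, matU_xa1]
    ext i
    fin_cases i
    · simp; field_simp
    · simp; field_simp; rw [h2]
  exact absurd ⟨hl, hm, h1, h2⟩ h

theorem repU_one (p : Fin 2 → ℂ) : repU 1 p = p := by simp

/-- No nontrivial element has a common eigenvalue on some `T_x` and on `U`: at `-1` the values are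
`1` and `-1`, and at noncentral elements their squares are `1` and `-1`. -/
theorem eigen_of_nonempty {A : Finset V4} (hA : A.Nonempty) {p q : Fin 2 → ℂ} (hp : p ≠ 0)
    (h : ((indVec A, p, q) : (V4 → ℂ) × (Fin 2 → ℂ) × (Fin 2 → ℂ)) ≠ 0) :
    (ofVec repQ8 (indVec A, p, q) h).eigen = {(1, 1)} := by
  ext ⟨g, c⟩
  rw [mem_eigen_model, Set.mem_singleton_iff, Prod.mk.injEq]
  constructor
  · rintro ⟨h1, h2, -⟩
    obtain ⟨x, hx⟩ := hA
    have h3 := h1 x hx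
    by_cases hg : g = 1
    · subst hg
      exact ⟨rfl, by rw [← h3, sgn_one]⟩
    · by_cases hg' : g = a 2
      · subst hg'
        rw [repU_a2, neg_eq_smul_iff_of_ne_zero hp, ← h3, sgn_a2] at h2
        norm_num at h2
      · have h4 := eigenvalue_sq hg hg' hp h2
        rw [← h3, sgn_mul_self] at h4
        norm_num at h4
  · rintro ⟨rfl, rfl⟩
    exact ⟨fun x _ => sgn_one x, by simp, by simp⟩

theorem eigen_of_empty {p q : Fin 2 → ℂ} (hp : p ≠ 0)
    (hpq : ∀ g : Q8, g ≠ 1 → g ≠ a 2 → ∀ c : ℂ, repU g p = c • p → repU g q = c • q → False)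
    (h : ((indVec ∅, p, q) : (V4 → ℂ) × (Fin 2 → ℂ) × (Fin 2 → ℂ)) ≠ 0) :
    (ofVec repQ8 (indVec ∅, p, q) h).eigen = {(1, 1), (a 2, -1)} := by
  ext ⟨g, c⟩
  rw [mem_eigen_model, Set.mem_insert_iff, Set.mem_singleton_iff, Prod.mk.injEq, Prod.mk.injEq]
  constructor
  · rintro ⟨-, h2, h3⟩
    by_cases hg : g = 1
    · subst hg
      rw [repU_one, smul_eq_iff_of_ne_zero hp] at h2
      exact Or.inl ⟨rfl, h2⟩
    · by_cases hg' : g = a 2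
      · subst hg'
        rw [repU_a2, neg_eq_smul_iff_of_ne_zero hp] at h2
        exact Or.inr ⟨rfl, h2⟩
      · exact (hpq g hg hg' c h2 h3).elim
  · rintro (⟨rfl, rfl⟩ | ⟨rfl, rfl⟩)
    · simp
    · simp [repU_a2]

theorem star_not_eigen (g : Q8) (hg : g ≠ 1) (hg' : g ≠ a 2) (c : ℂ)
    (h : repU g ![1, 0] = c • ![1, 0]) (h' : repU g ![0, 1] = c • ![0, 1]) : False := by
  simpa using det_eq_zero_of_eigen hg hg' h h'

theorem model_ne_zero {A : Finset V4} {p q : Fin 2 → ℂ} (hp : p ≠ 0) :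
    ((indVec A, p, q) : (V4 → ℂ) × (Fin 2 → ℂ) × (Fin 2 → ℂ)) ≠ 0 := fun h =>
  hp (congrArg (fun t => t.2.1) h)

theorem vec_ne_zero {l m : ℂ} (h : (l, m) ≠ (0, 0)) : (![l, m] : Fin 2 → ℂ) ≠ 0 := by
  intro h0
  exact h (Prod.ext (congrFun h0 0) (congrFun h0 1))

theorem vec_star_ne_zero : (![1, 0] : Fin 2 → ℂ) ≠ 0 := vec_ne_zero (by simp)

theorem chiStar_eq (A : Finset V4) :
    chiStar A = MonoidAlgebra.of ℚ _ (ofVec repQ8 (indVec A, ![1, 0], ![0, 1])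
      (model_ne_zero vec_star_ne_zero)) := chi_of_ne _ _

theorem chiPoint_eq (A : Finset V4) {l m : ℂ} (h : (![l, m] : Fin 2 → ℂ) ≠ 0) :
    chiPoint A l m = MonoidAlgebra.of ℚ _ (ofVec repQ8 (indVec A, ![l, m], 0)
      (model_ne_zero h)) := chi_of_ne _ _

/-- The ideal `I'` is contained in the Jacobson radical. -/
theorem idealI_le : idealI ≤ Ring.jacobson (CharAlg Q8) := by
  refine Ideal.span_le.2 ?_
  rintro _ ((⟨l, m, h, rfl⟩ | ⟨A, l, m, hA, h, rfl⟩) | ⟨A, hA, rfl⟩)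
  · have h0 : (![l, m] : Fin 2 → ℂ) ≠ 0 := vec_ne_zero (by simp [h.1])
    rw [chiPoint_eq _ h0, chiStar_eq]
    refine mem_jacobson_iff.2 (Submodule.subset_span ⟨_, _, ?_, rfl⟩)
    rw [eigen_of_empty h0 (fun g hg hg' c hc _ => not_isGeneric_of_eigen hg hg' hc h),
      eigen_of_empty vec_star_ne_zero star_not_eigen]
  · have h0 : (![l, m] : Fin 2 → ℂ) ≠ 0 := vec_ne_zero h
    rw [chiPoint_eq _ h0, chiStar_eq]
    refine mem_jacobson_iff.2 (Submodule.subset_span ⟨_, _, ?_, rfl⟩)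
    rw [eigen_of_nonempty hA h0, eigen_of_nonempty Finset.univ_nonempty vec_star_ne_zero]
  · rw [chiStar_eq, chiStar_eq]
    refine mem_jacobson_iff.2 (Submodule.subset_span ⟨_, _, ?_, rfl⟩)
    rw [eigen_of_nonempty hA vec_star_ne_zero,
      eigen_of_nonempty Finset.univ_nonempty vec_star_ne_zero]

/-! ### The two summands of the radical -/

theorem exists_smul_of_det_eq_zero {p p' : Fin 2 → ℂ} (hp : p ≠ 0)
    (h : p 0 * p' 1 - p 1 * p' 0 = 0) : ∃ d : ℂ, p' = d • p := by
  by_cases h0 : p 0 = 0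
  · have h1 : p 1 ≠ 0 := fun h1 => hp (by ext i; fin_cases i <;> simp [h0, h1])
    have h2 : p' 0 = 0 := by simpa [h0, h1] using h
    refine ⟨p' 1 / p 1, ?_⟩
    ext i
    fin_cases i
    · simp [h0, h2]
    · simp [h1]
  · refine ⟨p' 0 / p 0, ?_⟩
    ext i
    fin_cases i
    · simp [h0]
    · simp
      field_simp
      linear_combination h

theorem model_eq_of_smul {p : Fin 2 → ℂ} {d : ℂ} (hp : p ≠ 0) (hp' : d • p ≠ 0) :
    ofVec repQ8 (indVec ∅, d • p, 0) (model_ne_zero hp') =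
      ofVec repQ8 (indVec ∅, p, 0) (model_ne_zero hp) := by
  have hd : d ≠ 0 := by rintro rfl; simp at hp'
  have e : ((indVec ∅, d • p, 0) : (V4 → ℂ) × (Fin 2 → ℂ) × (Fin 2 → ℂ)) =
      d • (indVec ∅, p, 0) := by simp [indVec_empty]
  refine ofVec_eq ⟨d⁻¹ • LinearMap.id, fun g => ?_⟩ ⟨d • LinearMap.id, fun g => ?_⟩
  · rw [e, map_smul, LinearMap.smul_apply, LinearMap.id_apply, smul_smul, inv_mul_cancel₀ hd,
      one_smul]
  · rw [e, map_smul, LinearMap.smul_apply, LinearMap.id_apply]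

theorem eigen_inflation {G H : Type} [Group G] [Group H] (f : G →* H) (s : GliderClass H) (g : G)
    (c : ℂ) : (g, c) ∈ (inflation f s).eigen ↔ (f g, c) ∈ s.eigen := by
  obtain ⟨_, _, _, ρ, v, hv, rfl⟩ := s.exists_ofVec
  rw [inflation_ofVec, mem_eigen_ofVec, mem_eigen_ofVec]
  rfl

/-- Two classes with the same eigenvalues that contain `U` have difference in `I'`. -/
theorem sub_mem_idealI {A B : Finset V4} {p q p' q' : Fin 2 → ℂ} (hp : p ≠ 0) (hp' : p' ≠ 0)
    (hq : q = 0 ∨ (p = ![1, 0] ∧ q = ![0, 1])) (hq' : q' = 0 ∨ (p' = ![1, 0] ∧ q' = ![0, 1]))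
    (h : (ofVec repQ8 (indVec A, p, q) (model_ne_zero hp)).eigen =
      (ofVec repQ8 (indVec B, p', q') (model_ne_zero hp')).eigen) :
    MonoidAlgebra.of ℚ _ (ofVec repQ8 (indVec A, p, q) (model_ne_zero hp)) -
      MonoidAlgebra.of ℚ _ (ofVec repQ8 (indVec B, p', q') (model_ne_zero hp')) ∈ idealI := by
  have vec : ∀ p : Fin 2 → ℂ, p = ![p 0, p 1] := fun p => by ext i; fin_cases i <;> rfl
  -- Once `U` occurs, the eigenvalue `-1` at the central element detects whether some `T_x` occurs
  -- too.
  have hne : ∀ {A : Finset V4} {p q : Fin 2 → ℂ} (hp : p ≠ 0),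
      (a 2, (-1 : ℂ)) ∈ (ofVec repQ8 (indVec A, p, q) (model_ne_zero hp)).eigen ↔ A = ∅ := by
    intro A p q hp
    rw [mem_eigen_model]
    constructor
    · rintro ⟨h, -⟩
      refine Finset.eq_empty_of_forall_notMem fun x hx => ?_
      have := h x hx
      rw [sgn_a2] at this
      norm_num at this
    · rintro rfl
      simp [repU_a2]
  have hAB : A = ∅ ↔ B = ∅ := by rw [← hne hp (q := q), h, hne hp']
  have sub : ∀ {s t : GliderClass Q8} (z : CharAlg Q8), MonoidAlgebra.of ℚ _ s - z ∈ idealI →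
      MonoidAlgebra.of ℚ _ t - z ∈ idealI →
      MonoidAlgebra.of ℚ _ s - MonoidAlgebra.of ℚ _ t ∈ idealI := by
    intro s t z h1 h2
    simpa using Ideal.sub_mem _ h1 h2
  by_cases hA : A = ∅
  · have hB := hAB.1 hA
    subst hA hB
    -- Either the class is congruent to `χ_(∅, ∗)` modulo `I'`, or it comes from one of the six
    -- special points.
    have gen : ∀ {p q : Fin 2 → ℂ} (hp : p ≠ 0) (_ : q = 0 ∨ (p = ![1, 0] ∧ q = ![0, 1])),
        MonoidAlgebra.of ℚ _ (ofVec repQ8 (indVec ∅, p, q) (model_ne_zero hp)) - chiStar ∅ ∈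
          idealI ∨ (q = 0 ∧ ∃ g : Q8, g ≠ 1 ∧ g ≠ a 2 ∧ ∃ c : ℂ, repU g p = c • p) := by
      rintro p q hp (rfl | ⟨rfl, rfl⟩)
      · by_cases hg : IsGeneric (p 0) (p 1)
        · left
          refine Ideal.subset_span (Or.inl (Or.inl ⟨p 0, p 1, hg, ?_⟩))
          rw [chiPoint_eq _ (by rwa [← vec])]
          simp only [← vec]
        · right
          refine ⟨rfl, ?_⟩
          have := exists_eigen_of_not_isGeneric hg
          rwa [← vec] at this
      · left
        rw [chiStar_eq, sub_self]
        exact Ideal.zero_mem _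
    -- At a special point an eigenpair of a noncentral element determines the line, so equal
    -- eigenvalues force equal classes.
    have special : ∀ {p p' q' : Fin 2 → ℂ} (hp : p ≠ 0) (hp' : p' ≠ 0)
        (_ : q' = 0 ∨ (p' = ![1, 0] ∧ q' = ![0, 1])),
        (ofVec repQ8 (indVec ∅, p, 0) (model_ne_zero hp)).eigen =
          (ofVec repQ8 (indVec ∅, p', q') (model_ne_zero hp')).eigen →
        (∃ g : Q8, g ≠ 1 ∧ g ≠ a 2 ∧ ∃ c : ℂ, repU g p = c • p) →
        ofVec repQ8 (indVec ∅, p, 0) (model_ne_zero hp) =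
          ofVec repQ8 (indVec ∅, p', q') (model_ne_zero hp') := by
      rintro p p' q' hp hp' hq' h ⟨g, hg, hg', c, hc⟩
      have h1 : (g, c) ∈ (ofVec repQ8 (indVec ∅, p, 0) (model_ne_zero hp)).eigen :=
        mem_eigen_model.2 ⟨by simp, hc, by simp⟩
      rw [h, mem_eigen_model] at h1
      rcases hq' with rfl | ⟨rfl, rfl⟩
      · obtain ⟨d, rfl⟩ := exists_smul_of_det_eq_zero hp (det_eq_zero_of_eigen hg hg' hc h1.2.1)
        exact (model_eq_of_smul hp hp').symm
      · exact (star_not_eigen g hg hg' c h1.2.1 h1.2.2).elim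
    rcases gen hp hq with h1 | ⟨rfl, h1⟩
    · rcases gen hp' hq' with h2 | ⟨rfl, h2⟩
      · exact sub _ h1 h2
      · rw [special hp' hp hq h.symm h2, sub_self]
        exact Ideal.zero_mem _
    · rw [special hp hp' hq' h h1, sub_self]
      exact Ideal.zero_mem _
  · have hB : ¬ B = ∅ := fun hB => hA (hAB.2 hB)
    have gen : ∀ {A : Finset V4} {p q : Fin 2 → ℂ} (_ : A.Nonempty) (hp : p ≠ 0)
        (_ : q = 0 ∨ (p = ![1, 0] ∧ q = ![0, 1])),
        MonoidAlgebra.of ℚ _ (ofVec repQ8 (indVec A, p, q) (model_ne_zero hp)) -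
          chiStar Finset.univ ∈ idealI := by
      rintro A p q hA hp (rfl | ⟨rfl, rfl⟩)
      · refine Ideal.subset_span (Or.inl (Or.inr ⟨A, p 0, p 1, hA, ?_, ?_⟩))
        · intro h0
          exact hp (by rw [vec p, (Prod.mk.inj h0).1, (Prod.mk.inj h0).2]; simp)
        · rw [chiPoint_eq _ (by rwa [← vec])]
          simp only [← vec]
      · exact Ideal.subset_span (Or.inr ⟨A, hA, by rw [chiStar_eq A]⟩)
    exact sub _ (gen (Finset.nonempty_iff_ne_empty.2 hA) hp hq)
      (gen (Finset.nonempty_iff_ne_empty.2 hB) hp' hq')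

theorem sub_mem_map_jacobson {A B : Finset V4}
    {hv : ((indVec A, 0, 0) : (V4 → ℂ) × (Fin 2 → ℂ) × (Fin 2 → ℂ)) ≠ 0}
    {hw : ((indVec B, 0, 0) : (V4 → ℂ) × (Fin 2 → ℂ) × (Fin 2 → ℂ)) ≠ 0}
    (h : (ofVec repQ8 (indVec A, 0, 0) hv).eigen = (ofVec repQ8 (indVec B, 0, 0) hw).eigen) :
    ∃ x ∈ Ring.jacobson (CharAlg V4), inflationAlg toV4 x =
      MonoidAlgebra.of ℚ _ (ofVec repQ8 (indVec A, 0, 0) hv) -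
        MonoidAlgebra.of ℚ _ (ofVec repQ8 (indVec B, 0, 0) hw) := by
  have hA : indVec A ≠ 0 := fun h => hv (by rw [h]; rfl)
  have hB : indVec B ≠ 0 := fun h => hw (by rw [h]; rfl)
  rw [← inflation_indVec hA, ← inflation_indVec hB] at h ⊢
  refine ⟨MonoidAlgebra.of ℚ _ (ofVec repV4 (indVec A) hA) -
    MonoidAlgebra.of ℚ _ (ofVec repV4 (indVec B) hB), ?_, ?_⟩
  · refine mem_jacobson_iff.2 (Submodule.subset_span ⟨_, _, ?_, rfl⟩)
    ext ⟨g, c⟩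
    obtain ⟨g, rfl⟩ := toV4_surjective g
    rw [← eigen_inflation, ← eigen_inflation, h]
  · rw [map_sub, inflationAlg_of, inflationAlg_of]

theorem jacobson_Q8 : (Ring.jacobson (CharAlg Q8)).restrictScalars ℚ =
    idealI.restrictScalars ℚ ⊔
      ((Ring.jacobson (CharAlg V4)).restrictScalars ℚ).map (inflationAlg toV4).toLinearMap := by
  refine le_antisymm (fun x hx => ?_) (sup_le idealI_le ?_)
  · have hx' : x ∈ eigenSpan Q8 := mem_jacobson_iff.1 hx
    revert hx'
    suffices h : eigenSpan Q8 ≤ _ from fun hx' => h hx'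
    refine Submodule.span_le.2 ?_
    rintro _ ⟨s, t, h, rfl⟩
    obtain ⟨A, p, q, hv, rfl, hpq⟩ := exists_eq_model s
    obtain ⟨B, p', q', hw, rfl, hpq'⟩ := exists_eq_model t
    -- Eigenvalue `1` at the central element means that `U` is absent. Hence `s` and `t` are either
    -- both inflated from `V₄` or both contain `U`.
    have hc : ∀ {A : Finset V4} {p q : Fin 2 → ℂ}
        {hv : ((indVec A, p, q) : (V4 → ℂ) × (Fin 2 → ℂ) × (Fin 2 → ℂ)) ≠ 0},
        (a 2, (1 : ℂ)) ∈ (ofVec repQ8 (indVec A, p, q) hv).eigen ↔ p = 0 ∧ q = 0 := by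
      intro A p q hv
      rw [mem_eigen_model, repU_a2, repU_a2, one_smul, one_smul, neg_eq_self, neg_eq_self]
      exact and_iff_right fun x _ => sgn_a2 x
    by_cases h0 : p = 0 ∧ q = 0
    · have h0' := (hc (hv := hw)).1 (by rw [← h]; exact hc.2 h0)
      obtain ⟨rfl, rfl⟩ := h0
      obtain ⟨rfl, rfl⟩ := h0'
      refine Submodule.mem_sup_right ?_
      exact sub_mem_map_jacobson h
    · have h0' : ¬ (p' = 0 ∧ q' = 0) := fun h' => h0 (hc.1 (by rw [h]; exact hc.2 h'))
      refine Submodule.mem_sup_left ?_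
      have key : ∀ {p q : Fin 2 → ℂ}, ¬ (p = 0 ∧ q = 0) →
          ((p = 0 ∧ q = 0) ∨ (p ≠ 0 ∧ q = 0) ∨ (p = ![1, 0] ∧ q = ![0, 1])) →
          p ≠ 0 ∧ (q = 0 ∨ (p = ![1, 0] ∧ q = ![0, 1])) := by
        rintro p q h (h1 | ⟨h1, h2⟩ | ⟨rfl, rfl⟩)
        · exact (h h1).elim
        · exact ⟨h1, Or.inl h2⟩
        · exact ⟨vec_star_ne_zero, Or.inr ⟨rfl, rfl⟩⟩
      obtain ⟨hp, hq⟩ := key h0 hpq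
      obtain ⟨hp', hq'⟩ := key h0' hpq'
      exact sub_mem_idealI hp hp' hq hq' h
  · rintro _ ⟨x, hx, rfl⟩
    exact mem_jacobson_of_isNilpotent
      ((isNilpotent_of_mem_eigenSpan (mem_jacobson_iff.1 hx)).map (inflationAlg toV4))

end GliderQ8

namespace GliderQ8

open GliderClass QuaternionGroup

/-! ### The semisimple quotient for the quaternion group -/

/-- Generators of the three cyclic subgroups of order four. -/
def gen : Fin 3 → Q8 := ![a 1, xa 0, xa 1]

/-- The cyclic subgroups of order four. -/
def cyc (i : Fin 3) : Subgroup Q8 := Subgroup.zpowers (gen i)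

/-- The centre. -/
def cen : Subgroup Q8 := Subgroup.zpowers (a 2)

theorem orderOf_gen (i : Fin 3) : orderOf (gen i) = 4 :=
  orderOf_eq_prime_pow (p := 2) (n := 1) (by revert i; decide) (by revert i; decide)

theorem orderOf_a2 : orderOf (a 2 : Q8) = 2 :=
  orderOf_eq_prime (by decide) (by decide)

theorem card_cyc (i : Fin 3) : Nat.card (cyc i) = 4 :=
  (Nat.card_zpowers _).trans (orderOf_gen i)

theorem card_cen : Nat.card cen = 2 := (Nat.card_zpowers _).trans orderOf_a2

theorem card_top_Q8 : Nat.card (⊤ : Subgroup Q8) = 8 := by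
  rw [Subgroup.card_top, Nat.card_eq_fintype_card]; decide

theorem eq_top_of_gen_mem {C : Subgroup Q8} {i j : Fin 3} (hij : i ≠ j) (hi : gen i ∈ C)
    (hj : gen j ∈ C) : C = ⊤ := by
  refine Subgroup.eq_top_iff' C |>.2 fun g => ?_
  have : ∀ i j : Fin 3, i ≠ j → ∀ g : Q8, ∃ m n : Fin 4, g = gen i ^ (m : ℕ) * gen j ^ (n : ℕ) := by
    decide
  obtain ⟨m, n, rfl⟩ := this i j hij g
  exact C.mul_mem (C.pow_mem hi _) (C.pow_mem hj _)

/-- One exponent serves both ways: `k` is `1` or `3`, its own inverse modulo `4`. -/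
theorem noncentral (g : Q8) : g = 1 ∨ g = a 2 ∨
    ∃ (i : Fin 3) (k : Fin 4), gen i = g ^ (k : ℕ) ∧ g = gen i ^ (k : ℕ) := by
  revert g; decide

theorem a2_mem_cyc (i : Fin 3) : a 2 ∈ cyc i :=
  ⟨2, by revert i; decide⟩

/-- Every nontrivial subgroup contains `-1`, and elements of two different cyclic subgroups of order
four generate `Q₈` as soon as both are noncentral. -/
theorem subgroup_cases (C : Subgroup Q8) : C = ⊤ ∨ (∃ i, C = cyc i) ∨ C = cen ∨ C = ⊥ := by
  by_cases h2 : a 2 ∈ C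
  · by_cases hi : ∃ i, gen i ∈ C
    · obtain ⟨i, hi⟩ := hi
      by_cases ht : C = ⊤
      · exact Or.inl ht
      refine Or.inr (Or.inl ⟨i, le_antisymm (fun g hg => ?_) (by simpa [cyc] using hi)⟩)
      rcases noncentral g with rfl | rfl | ⟨j, k, h, h'⟩
      · exact one_mem _
      · exact a2_mem_cyc i
      · have hj : gen j ∈ C := h ▸ C.pow_mem hg _
        have hij : i = j := by
          by_contra hij
          exact ht (eq_top_of_gen_mem hij hi hj)
        rw [h', hij]
        exact Subgroup.pow_mem _ (Subgroup.mem_zpowers _) _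
    · refine Or.inr (Or.inr (Or.inl (le_antisymm (fun g hg => ?_) (by simpa [cen] using h2))))
      rcases noncentral g with rfl | rfl | ⟨j, k, h, h'⟩
      · exact one_mem _
      · exact Subgroup.mem_zpowers _
      · exact (hi ⟨j, h ▸ C.pow_mem hg _⟩).elim
  · refine Or.inr (Or.inr (Or.inr ((Subgroup.eq_bot_iff_forall C).2 fun g hg => ?_)))
    by_contra h1
    by_cases hg' : g = a 2
    · exact h2 (hg' ▸ hg)
    · have := (by decide : ∀ g : Q8, g ≠ 1 → g ≠ a 2 → g * g = a 2) g h1 hg'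
      exact h2 (this ▸ C.mul_mem hg hg)

theorem cyc_ne_top (i : Fin 3) : cyc i ≠ ⊤ := fun h => by
  have := card_cyc i
  rw [h, card_top_Q8] at this
  omega

theorem cyc_injective : Function.Injective cyc := fun i j h => by
  by_contra hij
  exact cyc_ne_top i (eq_top_of_gen_mem hij (Subgroup.mem_zpowers _)
    (by rw [h]; exact Subgroup.mem_zpowers _))

theorem cyc_ne_cen (i : Fin 3) : cyc i ≠ cen := fun h => by
  have := card_cyc i
  rw [h, card_cen] at this
  omega

theorem cyc_ne_bot (i : Fin 3) : cyc i ≠ ⊥ := fun h => by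
  have := card_cyc i
  rw [h, Subgroup.card_bot] at this
  omega

theorem cen_ne_bot : cen ≠ ⊥ := fun h => by
  have := card_cen
  rw [h, Subgroup.card_bot] at this
  omega

theorem cen_ne_top : cen ≠ ⊤ := fun h => by
  have := card_cen
  rw [h, card_top_Q8] at this
  omega

theorem Q8_bot_ne_top : (⊥ : Subgroup Q8) ≠ ⊤ := fun h => by
  have := card_top_Q8
  rw [← h, Subgroup.card_bot] at this
  omega

section Product

variable (R : Subgroup Q8 → Type) [∀ C, Ring (R C)] [∀ C, Algebra ℚ (R C)]

/-- A product over the subgroups of the quaternion group, written out. -/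
def piSubgroupHom : ((C : Subgroup Q8) → R C) →ₐ[ℚ]
    R ⊤ × ((i : Fin 3) → R (cyc i)) × R cen × R ⊥ :=
  (Pi.evalAlgHom ℚ R ⊤).prod ((AlgHom.pi fun i => Pi.evalAlgHom ℚ R (cyc i)).prod
    ((Pi.evalAlgHom ℚ R cen).prod (Pi.evalAlgHom ℚ R ⊥)))

theorem piSubgroupHom_apply (x : (C : Subgroup Q8) → R C) :
    piSubgroupHom R x = (x ⊤, fun i => x (cyc i), x cen, x ⊥) := rfl

theorem piSubgroupHom_bijective : Function.Bijective (piSubgroupHom R) := by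
  classical
  constructor
  · intro x y h
    simp only [piSubgroupHom_apply, Prod.mk.injEq] at h
    obtain ⟨h1, h2, h3, h4⟩ := h
    funext C
    rcases subgroup_cases C with rfl | ⟨i, rfl⟩ | rfl | rfl
    exacts [h1, congrFun h2 i, h3, h4]
  · rintro ⟨t, b, z, e⟩
    refine ⟨Pi.single ⊤ t + ∑ i, Pi.single (cyc i) (b i) + Pi.single cen z + Pi.single ⊥ e, ?_⟩
    rw [piSubgroupHom_apply]
    refine Prod.ext ?_ (Prod.ext (funext fun i => ?_) (Prod.ext ?_ ?_))
    · simp [Pi.single_eq_of_ne, cen_ne_top.symm, Q8_bot_ne_top.symm,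
        (cyc_ne_top _).symm]
    · simp only [Pi.add_apply, Finset.sum_apply]
      rw [Finset.sum_eq_single i]
      · simp [Pi.single_eq_of_ne, cyc_ne_top, cyc_ne_cen, cyc_ne_bot]
      · intro j _ hj
        exact Pi.single_eq_of_ne (fun h => hj (cyc_injective h.symm)) _
      · simp
    · simp [Pi.single_eq_of_ne, cen_ne_top, cen_ne_bot, (cyc_ne_cen _).symm]
    · simp [Pi.single_eq_of_ne, cen_ne_bot.symm, (cyc_ne_bot _).symm]

end Product

/-! ### Character groups of the subgroups and their group algebras -/

theorem nonempty_charGroup_equiv {G : Type} [Group G] [Finite G] (g : G) {n : ℕ}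
    (hn : orderOf g = n) :
    Nonempty (CharGroup (Subgroup.zpowers g) ≃* Multiplicative (ZMod n)) := by
  have : NeZero (Nat.card (Subgroup.zpowers g)) := ⟨Nat.card_pos.ne'⟩
  have e' : Subgroup.zpowers g ≃* Multiplicative (ZMod n) :=
    mulEquivOfCyclicCardEq ((Nat.card_zpowers g).trans (hn.trans (Nat.card_zmod n).symm))
  let : CommGroup (Subgroup.zpowers g) := IsCyclic.commGroup
  obtain ⟨e⟩ := IsCyclic.monoidHom_equiv_self (Subgroup.zpowers g) ℂ
  exact ⟨MulEquiv.trans (show CharGroup (Subgroup.zpowers g) ≃* Subgroup.zpowers g from e) e'⟩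

/-- The inclusion of the signs in the complex numbers. -/
def signHom : ℤˣ →* ℂˣ := Units.map (Int.castRingHom ℂ : ℤ →* ℂ)

/-- The linear characters of the quaternion group. -/
def topChar : V4 →* CharGroup (⊤ : Subgroup Q8) where
  toFun x := (signHom.comp ((linChar x).comp toV4)).comp (Subgroup.subtype ⊤)
  map_one' := MonoidHom.ext fun g => by
    change signHom (linChar 1 (toV4 g)) = 1
    rw [(by decide : ∀ y, linChar 1 y = 1), map_one]
  map_mul' x y := MonoidHom.ext fun g => by
    change signHom (linChar (x * y) (toV4 g)) =
      signHom (linChar x (toV4 g)) * signHom (linChar y (toV4 g))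
    rw [← map_mul, (by decide : ∀ x y z, linChar (x * y) z = linChar x z * linChar y z)]

theorem signHom_injective : Function.Injective signHom :=
  Units.map_injective (Int.cast_injective (α := ℂ))

/-- The relations `i j i = j` and `j² = i²` force a linear character to take values `±1` at `i` and
`j`, and the labels in `V₄` realise each pair of signs exactly once. -/
theorem topChar_bijective : Function.Bijective topChar := by
  constructor
  · intro x y h
    have h1 : ∀ g : Q8, linChar x (toV4 g) = linChar y (toV4 g) := fun g =>
      signHom_injective (congrArg
        (fun χ : CharGroup (⊤ : Subgroup Q8) =>
          (show (⊤ : Subgroup Q8) →* ℂˣ from χ) ⟨g, Subgroup.mem_top g⟩) h)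
    exact (by decide : ∀ x y : V4, linChar x (toV4 (a 1)) = linChar y (toV4 (a 1)) →
      linChar x (toV4 (xa 0)) = linChar y (toV4 (xa 0)) → x = y) x y (h1 _) (h1 _)
  · intro χ
    let ψ : Q8 →* ℂˣ := MonoidHom.comp χ (Subgroup.topEquiv.symm.toMonoidHom)
    have hJ : ψ (a 1) * ψ (a 1) = 1 := by
      have h1 : (a 1 : Q8) * xa 0 * a 1 = xa 0 := by decide
      have h2 := congrArg ψ h1
      rw [map_mul, map_mul, mul_right_comm] at h2
      exact mul_eq_right.1 h2
    have hI : ψ (xa 0) * ψ (xa 0) = 1 := by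
      rw [← map_mul, show (xa 0 : Q8) * xa 0 = a 1 * a 1 by decide, map_mul, hJ]
    have sq : ∀ {u : ℂˣ}, u * u = 1 → ∃ s : ℤˣ, signHom s = u := by
      intro u hu
      have h1 : (u : ℂ) * u = 1 := by rw [← Units.val_mul, hu, Units.val_one]
      rcases mul_self_eq_one_iff.1 h1 with h | h
      · exact ⟨1, Units.ext (by rw [h, map_one]; rfl)⟩
      · exact ⟨-1, Units.ext (by rw [h]; simp [signHom])⟩
    obtain ⟨s, hs⟩ := sq hJ
    obtain ⟨t, ht⟩ := sq hI
    obtain ⟨x, hx1, hx2⟩ := (by decide : ∀ s t : ℤˣ, ∃ x : V4, linChar x (toV4 (a 1)) = s ∧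
      linChar x (toV4 (xa 0)) = t) s t
    refine ⟨x, MonoidHom.ext fun g => ?_⟩
    obtain ⟨g, hg⟩ := g
    change signHom (linChar x (toV4 g)) = ψ g
    obtain ⟨m, n, rfl⟩ := (by decide : ∀ g : Q8, ∃ m n : Fin 4, g = xa 0 ^ (m : ℕ) * a 1 ^ (n : ℕ)) g
    simp only [map_mul, map_pow, hx1, hx2, hs, ht]

/-- The group algebra of the group of order two splits. -/
def signAlg : MonoidAlgebra ℚ (Multiplicative (ZMod 2)) →ₐ[ℚ] (Fin 2 → ℚ) :=
  MonoidAlgebra.lift ℚ _ _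
    { toFun := fun x => ![1, if x = 1 then 1 else -1]
      map_one' := by ext i; fin_cases i <;> simp
      map_mul' := by
        have h : ∀ x y : Multiplicative (ZMod 2), ((if x * y = 1 then 1 else -1 : ℚ)) =
          (if x = 1 then 1 else -1) * (if y = 1 then 1 else -1) := by
          intro x y
          have h1 := (by decide : ∀ x y : Multiplicative (ZMod 2),
            x * y = 1 ↔ (x = 1 ↔ y = 1)) x y
          by_cases hx : x = 1 <;> by_cases hy : y = 1 <;> simp [h1, hx, hy]
        intro x y
        ext i
        fin_cases i
        · simp
        · simp [h] }

theorem signAlg_bijective : Function.Bijective signAlg := by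
  have hs : Function.Surjective signAlg.toLinearMap := by
    intro y
    -- Fourier inversion on the group of order two.
    refine ⟨MonoidAlgebra.single 1 ((y 0 + y 1) / 2) +
      MonoidAlgebra.single (Multiplicative.ofAdd 1) ((y 0 - y 1) / 2), ?_⟩
    rw [AlgHom.toLinearMap_apply, map_add, signAlg, MonoidAlgebra.lift_single,
      MonoidAlgebra.lift_single]
    have h1 : (Multiplicative.ofAdd 1 : Multiplicative (ZMod 2)) ≠ 1 := by decide
    ext i
    fin_cases i
    · simp
      ring
    · simp [h1]
      ring
  refine ⟨(LinearMap.injective_iff_surjective_of_finrank_eq_finrank ?_).2 hs, hs⟩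
  rw [finrank_monoidAlgebra, Module.finrank_fin_fun]
  rfl

theorem nonempty_quotient_equiv : Nonempty
    ((CharAlg Q8 ⧸ Ring.jacobson (CharAlg Q8)) ≃ₐ[ℚ]
      (MonoidAlgebra ℚ V4 ×
        (Fin 3 → MonoidAlgebra ℚ (Multiplicative (ZMod 4))) × (Fin 2 → ℚ) × ℚ)) := by
  let e1 := (Ideal.quotientEquivAlgOfEq ℚ (jacobson_eq_ker (G := Q8))).trans
    (Ideal.quotientKerAlgEquivOfSurjective (eigAlgPi_surjective (G := Q8)))
  let e2 := AlgEquiv.ofBijective _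
    (piSubgroupHom_bijective fun C => MonoidAlgebra ℚ (CharGroup C))
  let t1 : MonoidAlgebra ℚ (CharGroup (⊤ : Subgroup Q8)) ≃ₐ[ℚ] MonoidAlgebra ℚ V4 :=
    MonoidAlgebra.domCongr ℚ ℚ (MulEquiv.ofBijective topChar topChar_bijective).symm
  have t2 : ∀ i, MonoidAlgebra ℚ (CharGroup (cyc i)) ≃ₐ[ℚ]
      MonoidAlgebra ℚ (Multiplicative (ZMod 4)) := fun i =>
    MonoidAlgebra.domCongr ℚ ℚ (nonempty_charGroup_equiv _ (orderOf_gen i)).some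
  have t3 : MonoidAlgebra ℚ (CharGroup cen) ≃ₐ[ℚ] (Fin 2 → ℚ) :=
    (MonoidAlgebra.domCongr ℚ ℚ (nonempty_charGroup_equiv _ orderOf_a2).some).trans
      (AlgEquiv.ofBijective signAlg signAlg_bijective)
  have : Subsingleton (CharGroup (⊥ : Subgroup Q8)) :=
    ⟨fun χ ψ => MonoidHom.ext fun g => by
      rw [Subsingleton.elim g 1]
      exact (MonoidHom.map_one χ).trans (MonoidHom.map_one ψ).symm⟩
  -- The trivial subgroup has a single character and accounts for the last factor `ℚ`.
  let t4 : MonoidAlgebra ℚ (CharGroup (⊥ : Subgroup Q8)) ≃ₐ[ℚ] ℚ :=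
    AlgEquiv.ofRingEquiv (f := MonoidAlgebra.uniqueRingEquiv _) fun r => by
      simp [MonoidAlgebra.uniqueRingEquiv]
  exact ⟨(e1.trans e2).trans
    (AlgEquiv.prodCongr t1 (AlgEquiv.prodCongr (AlgEquiv.piCongrRight t2)
      (AlgEquiv.prodCongr t3 t4)))⟩

end GliderQ8

end

theorem mainTheorem6 :
    ∃ ι : GliderQ8.CharAlg GliderQ8.V4 →ₐ[ℚ] GliderQ8.CharAlg GliderQ8.Q8,
      Function.Injective ι ∧
      (∀ A : Finset GliderQ8.V4, ι (GliderQ8.chiV4 A) = GliderQ8.chiEmpty A) ∧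
      (Ring.jacobson (GliderQ8.CharAlg GliderQ8.Q8)).restrictScalars ℚ =
        GliderQ8.idealI.restrictScalars ℚ ⊔
          ((Ring.jacobson (GliderQ8.CharAlg GliderQ8.V4)).restrictScalars ℚ).map ι.toLinearMap ∧
      Nonempty
        ((GliderQ8.CharAlg GliderQ8.Q8 ⧸ Ring.jacobson (GliderQ8.CharAlg GliderQ8.Q8)) ≃ₐ[ℚ]
          (MonoidAlgebra ℚ GliderQ8.V4 ×
            (Fin 3 → MonoidAlgebra ℚ (Multiplicative (ZMod 4))) × (Fin 2 → ℚ) × ℚ)) :=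
  ⟨GliderQ8.inflationAlg GliderQ8.toV4,
    GliderQ8.inflationAlg_injective GliderQ8.toV4_surjective,
    GliderQ8.inflationAlg_chiV4, GliderQ8.jacobson_Q8, GliderQ8.nonempty_quotient_equiv⟩
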